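/- Let $B\subset\mathbb{R}^{d+k}$ ($d\ge 1$, $k\ge 0$) be a non-empty compact smooth embedded $d$-dimensional submanifold, with or without boundary, with induced metric $g_B$, normal bundle $NB$ and second fundamental form $\mathrm{II}$. For $r>0$ let $\overline{NB}_r=\{(x,\nu)\in NB:\|\nu\|\le r\}$ and $NB_r=\{(x,\nu)\in NB:\|\nu\|<r\}$. For $\varepsilon>0$ let $g^\varepsilon$ be the pullback of the Euclidean metric of $\mathbb{R}^{d+k}$ by the map $NB\to\mathbb{R}^{d+k}$, $(x,\nu)\mapsto x+\varepsilon\nu$. Given local coordinates $x^1,\dots,x^d$ on $B$ and a smooth local orthonormal frame $e_1,\dots,e_k$ of $NB$ over the same domain (these exist around every point of $B$), write $\nu=\sum_\alpha n^\alpha e_\alpha$, use $(x^1,\dots,x^d,n^1,\dots,n^k)$ as local coordinates on $NB$, let $g_B(x)$ and $g^\varepsilon(x,n)$ also denote the matrices of the two metrics in these coordinates, and put $(H_\alpha)_{ij}=\langle e_\alpha,\mathrm{II}(\partial_{x^i},\partial_{x^j})\rangle$. Let $$\kappa(x)=\max_{\|v\|_2=1}\Big(\sum_{\alpha=1}^{k}\big(v^{T}g_B(x)^{-1/2}H_\alpha(x)\,g_B(x)^{-1/2}v\big)^2\Big)^{1/2},\qquad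 \kappa^*=\max_{x\in B}\kappa(x).$$ Then the following hold. These maxima exist, and $\kappa(x)$ does not depend on the coordinates and the frame. The metric $g^\varepsilon$ is positive definite at every point of the closed bundle $\overline{NB}_r$ if and only if $\varepsilon r\kappa^*<1$, and it is positive definite at every point of the open bundle $NB_r$ if and only if $\varepsilon r\kappa^*\le 1$. Moreover, in all such coordinates and at every point of $\overline{NB}_r$, $$\det(g^\varepsilon)\le\varepsilon^{2k}\det(g_B)\,(1+\varepsilon r\kappa^*)^{2d},$$ and, if $\varepsilon r\kappa^*\le 1$, also $$\varepsilon^{2k}\det(g_B)\,(1-\varepsilon r\kappa^*)^{2d}\le\det(g^\varepsilon).$$ -/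

import Mathlib

open scoped Manifold ContDiff

namespace TubeMetric

noncomputable section

/-- The smooth manifold `M` (with or without boundary, according to the model `I`) is smoothly
embedded in `ℝ^(d+k)` by `f`; the submanifold is `B = f(M)`, identified with `M`. -/
structure IsEmbeddedSubmanifold {d k : ℕ} {H : Type*} [TopologicalSpace H]
    (I : ModelWithCorners ℝ (EuclideanSpace ℝ (Fin d)) H)
    {M : Type*} [TopologicalSpace M] [ChartedSpace H M]
    (f : M → EuclideanSpace ℝ (Fin (d + k))) : Prop where
  contMDiff : ContMDiff I 𝓘(ℝ, EuclideanSpace ℝ (Fin (d + k))) ∞ f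
  injective_mfderiv : ∀ x : M,
    Function.Injective (mfderiv I 𝓘(ℝ, EuclideanSpace ℝ (Fin (d + k))) f x)
  isEmbedding : Topology.IsEmbedding f

section

variable {d k : ℕ} {H : Type*} [TopologicalSpace H]
  (I : ModelWithCorners ℝ (EuclideanSpace ℝ (Fin d)) H)
  {M : Type*} [TopologicalSpace M] [ChartedSpace H M]
  (f : M → EuclideanSpace ℝ (Fin (d + k)))

/-- The differential of the embedding, as a linear map `ℝ^d → ℝ^(d+k)`. -/
def differential (x : M) : EuclideanSpace ℝ (Fin d) →L[ℝ] EuclideanSpace ℝ (Fin (d + k)) :=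
  mfderiv I 𝓘(ℝ, EuclideanSpace ℝ (Fin (d + k))) f x

/-- The tangent space of the submanifold at `f x`, as a subspace of `ℝ^(d+k)`. -/
def tangentSubspace (x : M) : Submodule ℝ (EuclideanSpace ℝ (Fin (d + k))) :=
  (differential I f x).range

/-- The normal space of the submanifold at `f x`. -/
def normalSubspace (x : M) : Submodule ℝ (EuclideanSpace ℝ (Fin (d + k))) :=
  (tangentSubspace I f x)ᗮ

/-- The closed disc bundle `{(x, ν) : ν normal at x, ‖ν‖ ≤ r}`. -/
def closedNormalBundle (r : ℝ) : Set (M × EuclideanSpace ℝ (Fin (d + k))) :=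
  {p | p.2 ∈ normalSubspace I f p.1 ∧ ‖p.2‖ ≤ r}

/-- The open disc bundle `{(x, ν) : ν normal at x, ‖ν‖ < r}`. -/
def openNormalBundle (r : ℝ) : Set (M × EuclideanSpace ℝ (Fin (d + k))) :=
  {p | p.2 ∈ normalSubspace I f p.1 ∧ ‖p.2‖ < r}

/-- The map `(x, ν) ↦ x + ν` into `ℝ^(d+k)`. -/
def bundleToSpace (p : M × EuclideanSpace ℝ (Fin (d + k))) : EuclideanSpace ℝ (Fin (d + k)) :=
  f p.1 + p.2

/-- The scaling `(x, ν) ↦ (x, ε ν)`. -/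
def scaling (ε : ℝ) (p : M × EuclideanSpace ℝ (Fin (d + k))) :
    M × EuclideanSpace ℝ (Fin (d + k)) :=
  (p.1, ε • p.2)

/-- Local coordinates on the normal bundle: a smooth chart of the manifold and, over its domain,
a smooth orthonormal frame `e_1, …, e_k` of the normal bundle. -/
structure BundleCoords where
  chart : OpenPartialHomeomorph M H
  chart_mem : chart ∈ IsManifold.maximalAtlas I ∞ M
  frame : Fin k → M → EuclideanSpace ℝ (Fin (d + k))
  frame_smooth : ∀ α, ContMDiffOn I 𝓘(ℝ, EuclideanSpace ℝ (Fin (d + k))) ∞ (frame α) chart.source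
  frame_normal : ∀ α, ∀ x ∈ chart.source, frame α x ∈ normalSubspace I f x
  frame_orthonormal : ∀ x ∈ chart.source, Orthonormal ℝ (fun α => frame α x)

variable {I f}

namespace BundleCoords

variable (c : BundleCoords I f)

/-- The set of coordinate values `(x^1, …, x^d)` of the chart. -/
def domain : Set (EuclideanSpace ℝ (Fin d)) := (c.chart.extend I).target

/-- The coordinates `(x^1, …, x^d)` of a point of the manifold. -/
def coord (x : M) : EuclideanSpace ℝ (Fin d) := c.chart.extend I x

/-- The point of the manifold with coordinates `u`. -/
def point (u : EuclideanSpace ℝ (Fin d)) : M := (c.chart.extend I).symm u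

/-- The point `(x, n^α e_α(x))` of the normal bundle with coordinates `(u, n)`. -/
def bundlePoint (q : EuclideanSpace ℝ (Fin d) × EuclideanSpace ℝ (Fin k)) :
    M × EuclideanSpace ℝ (Fin (d + k)) :=
  (c.point q.1, ∑ α, q.2 α • c.frame α (c.point q.1))

/-- The coordinate vector `∂_i ψ(u)` of the submanifold, `ψ` being `f` in coordinates.
Derivatives are taken within the model region `range I` (a half-space for a manifold with boundary,
everything for one without). -/
def tangentVec (i : Fin d) (u : EuclideanSpace ℝ (Fin d)) : EuclideanSpace ℝ (Fin (d + k)) :=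
  fderivWithin ℝ (fun y => f (c.point y)) (Set.range I) u (EuclideanSpace.single i 1)

/-- The matrix of the induced metric `g_B`. -/
def baseMetric (u : EuclideanSpace ℝ (Fin d)) : Matrix (Fin d) (Fin d) ℝ :=
  Matrix.of fun i j => inner ℝ (c.tangentVec i u) (c.tangentVec j u)

/-- The second fundamental form `II(∂_i, ∂_j)`: the normal part of the Euclidean derivative of
`∂_j` in the direction `∂_i`. -/
def secondFundamentalForm (i j : Fin d) (u : EuclideanSpace ℝ (Fin d)) :
    EuclideanSpace ℝ (Fin (d + k)) :=
  (normalSubspace I f (c.point u)).starProjection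
    (fderivWithin ℝ (c.tangentVec j) (Set.range I) u (EuclideanSpace.single i 1))

/-- The matrix `H_α` with entries `⟨e_α, II(∂_i, ∂_j)⟩`. -/
def shapeMatrix (α : Fin k) (u : EuclideanSpace ℝ (Fin d)) : Matrix (Fin d) (Fin d) ℝ :=
  Matrix.of fun i j => inner ℝ (c.frame α (c.point u)) (c.secondFundamentalForm i j u)

/-- The matrix `g_B^{-1/2}`, by functional calculus of the symmetric matrix `g_B`. -/
def baseMetricInvSqrt (u : EuclideanSpace ℝ (Fin d)) : Matrix (Fin d) (Fin d) ℝ :=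
  cfc (fun t : ℝ => (√t)⁻¹) (c.baseMetric u)

/-- `(∑_α (vᵀ g_B^{-1/2} H_α g_B^{-1/2} v)²)^{1/2}`. -/
def curvatureIn (u v : EuclideanSpace ℝ (Fin d)) : ℝ :=
  √ (∑ α, (v.ofLp ⬝ᵥ ((c.baseMetricInvSqrt u * c.shapeMatrix α u * c.baseMetricInvSqrt u).mulVec
    v.ofLp)) ^ 2)

/-- The coordinate vector fields `∂_1, …, ∂_d, ∂_{d+1}, …, ∂_{d+k}`. -/
def coordVec : Fin d ⊕ Fin k → EuclideanSpace ℝ (Fin d) × EuclideanSpace ℝ (Fin k)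
  | Sum.inl i => (EuclideanSpace.single i 1, 0)
  | Sum.inr α => (0, EuclideanSpace.single α 1)

/-- The matrix, in the coordinates `(x, n)`, of the metric `g^ε`: the pullback of the Euclidean
metric by the scaling followed by the map `(x, ν) ↦ x + ν`. -/
def scaledMetric (ε : ℝ) (q : EuclideanSpace ℝ (Fin d) × EuclideanSpace ℝ (Fin k)) :
    Matrix (Fin d ⊕ Fin k) (Fin d ⊕ Fin k) ℝ :=
  Matrix.of fun a b =>
    inner ℝ
      (fderivWithin ℝ (fun y => bundleToSpace f (scaling ε (c.bundlePoint y)))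
        (Set.range I ×ˢ Set.univ) q (coordVec a))
      (fderivWithin ℝ (fun y => bundleToSpace f (scaling ε (c.bundlePoint y)))
        (Set.range I ×ˢ Set.univ) q (coordVec b))

end BundleCoords

variable (I f)

/-- The metric `g^ε` is positive definite at every point of `S`. -/
def PosDefOn (ε : ℝ) (S : Set (M × EuclideanSpace ℝ (Fin (d + k)))) : Prop :=
  ∀ (c : BundleCoords I f) (u : EuclideanSpace ℝ (Fin d)) (n : EuclideanSpace ℝ (Fin k)),
    u ∈ c.domain → c.bundlePoint (u, n) ∈ S → (c.scaledMetric ε (u, n)).PosDef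

/-- The absolute maximum principal curvature `κ(x)` at a point. The supremum is over the unit
sphere and over the local coordinates around `x`, on which the inner value does not depend. -/
def absCurvature (x : M) : ℝ :=
  sSup {t | ∃ c : BundleCoords I f, x ∈ c.chart.source ∧
    ∃ v : EuclideanSpace ℝ (Fin d), ‖v‖ = 1 ∧ t = c.curvatureIn (c.coord x) v}

/-- The absolute maximum principal curvature `κ*` across the submanifold. -/
def maxAbsCurvature : ℝ := sSup (Set.range (absCurvature I f))

end

end

end TubeMetric

/-! In coordinates the metric $g^\varepsilon$ is the Gram matrix of the $d+k$ vectors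
$t_i+\varepsilon D_i$ and $\varepsilon e_\alpha$ of $\mathbb{R}^{d+k}$, where $t_i=\partial_i\psi$
and $D_i=\sum_\alpha n^\alpha\partial_i e_\alpha$. It is thus positive semidefinite, and positive
definite exactly when its determinant is nonzero.

The determinant is found by pairing these vectors with the family $(t,e)$, whose Gram determinant is
$\det g_B$ (`det_gram_sumElim`). The pairing matrix is block triangular, so the normal part of $D_i$
drops out. The tangential part is given by the Weingarten equation, $\langle
D_i,t_j\rangle=-\sum_\alpha n^\alpha (H_\alpha)_{ij}$ (`inner_fderivWithin_normal_field`). Hence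
(`det_scaledMetric`) $\det g^\varepsilon=\varepsilon^{2k}\det g_B\,\det(1-S)^2$ with $S=\varepsilon
g_B^{-1/2}(\sum_\alpha n^\alpha H_\alpha)g_B^{-1/2}$ symmetric. By Cauchy-Schwarz in $\alpha$,
$|v^TSv|\le\varepsilon\|n\|\kappa(x)\|v\|^2$, so the eigenvalues of $1-S$ lie within
$\varepsilon\|n\|\kappa(x)$ of $1$. This gives both determinant bounds and the sufficiency of the
curvature conditions. They are necessary because equality in Cauchy-Schwarz is attained: some $n$ of
length $1/(\varepsilon\kappa(x))$ makes $1-S$ singular (`exists_not_posDef`).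

The maxima exist because $\kappa(x)$ is the maximum of $\|\mathrm{II}(w,w)\|$ over unit tangent
vectors. This is independent of coordinates (`curvature_set_subset`) and continuous in $x$
(`continuous_absCurvature`) on a compact manifold. -/

namespace TubeMetric

open Matrix

/-! ### Gram determinants and symmetric perturbations of the identity -/

section LinearAlgebra

variable {ι κ m : Type*} [Fintype ι] [DecidableEq ι] [Fintype κ] [DecidableEq κ] [Fintype m]

/-- Cauchy-Binet in the square case, for Gram matrices. -/
theorem det_gram_mul_det_gram (σ : ι ≃ m) (v w : ι → EuclideanSpace ℝ m) :
    (gram ℝ v).det * (gram ℝ w).det = (Matrix.of fun i j => inner ℝ (v i) (w j)).det ^ 2 := by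
  -- There are as many vectors as coordinates, so after reindexing by `σ` every matrix of inner
  -- products factors into square matrices.
  have key : ∀ a b : ι → EuclideanSpace ℝ m, (Matrix.of fun i j => inner ℝ (a i) (b j)) =
      (Matrix.of fun i j => a i (σ j)) * (Matrix.of fun i j => b i (σ j))ᵀ := by
    intro a b
    ext i j
    simp only [Matrix.of_apply, Matrix.mul_apply, Matrix.transpose_apply, PiLp.inner_apply]
    rw [← σ.sum_comp]
    simp [mul_comm]
  have hg : ∀ a : ι → EuclideanSpace ℝ m,
      gram ℝ a = Matrix.of fun i j => inner ℝ (a i) (a j) := fun a => rfl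
  rw [hg, hg, key, key, key, det_mul, det_mul, det_mul, det_transpose, det_transpose]
  ring

/-- Gram determinant of a perturbation of a family together with a scaled orthonormal family of
vectors orthogonal to it. -/
theorem det_gram_sumElim (σ : ι ⊕ κ ≃ m) (t D : ι → EuclideanSpace ℝ m)
    (e : κ → EuclideanSpace ℝ m) (he : Orthonormal ℝ e) (hte : ∀ α i, inner ℝ (e α) (t i) = 0)
    (ε : ℝ) :
    (gram ℝ (Sum.elim (fun i => t i + ε • D i) (fun α => ε • e α))).det * (gram ℝ t).det =
      (ε ^ Fintype.card κ *
        (gram ℝ t + ε • Matrix.of fun i j => inner ℝ (D i) (t j)).det) ^ 2 := by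
  have h1 : (gram ℝ (Sum.elim t e)).det = (gram ℝ t).det := by
    have : gram ℝ (Sum.elim t e) = fromBlocks (gram ℝ t) 0 0 1 := by
      ext (i | i) (j | j)
      · simp [gram_apply]
      · simp [gram_apply, real_inner_comm (e j), hte]
      · simp [gram_apply, hte]
      · simp [gram_apply, Matrix.one_apply, orthonormal_iff_ite.1 he]
    rw [this, det_fromBlocks_zero₂₁, det_one, mul_one]
  have h2 := det_gram_mul_det_gram σ (Sum.elim (fun i => t i + ε • D i) (fun α => ε • e α))
    (Sum.elim t e)
  rw [h1] at h2
  rw [h2]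
  -- The lower left block vanishes since `e` is orthogonal to `t`, so the products of `D` with `e`
  -- do not affect the determinant.
  have h3 : (Matrix.of fun i j => inner ℝ
      ((Sum.elim (fun i => t i + ε • D i) (fun α => ε • e α) : ι ⊕ κ → EuclideanSpace ℝ m) i)
      (Sum.elim t e j)) =
      fromBlocks (gram ℝ t + ε • Matrix.of fun i j => inner ℝ (D i) (t j))
        (ε • Matrix.of fun i α => inner ℝ (D i) (e α)) 0 (ε • 1) := by
    ext (i | i) (j | j)
    · simp [gram_apply, inner_add_left, real_inner_smul_left]
    · simp [inner_add_left, real_inner_smul_left, real_inner_comm (e j) (t i), hte]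
    · simp [real_inner_smul_left, hte]
    · simp [Matrix.one_apply, orthonormal_iff_ite.1 he, real_inner_smul_left]
  rw [h3, det_fromBlocks_zero₂₁, det_smul, det_one, mul_one, mul_comm]

theorem invSqrt_isHermitian (g : Matrix ι ι ℝ) : (cfc (fun t : ℝ => (√t)⁻¹) g).IsHermitian :=
  cfc_predicate (R := ℝ) (fun t : ℝ => (√t)⁻¹) g

/-- The spectrum is finite, so every function is continuous on it, and the functional calculus
reduces the claim to a scalar identity at positive eigenvalues. -/
theorem invSqrt_mul_mul_invSqrt {g : Matrix ι ι ℝ} (hg : g.PosDef) :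
    cfc (fun t : ℝ => (√t)⁻¹) g * g * cfc (fun t : ℝ => (√t)⁻¹) g = 1 := by
  have hsa : IsSelfAdjoint g := hg.isHermitian
  have hfin : (spectrum ℝ g).Finite := Matrix.finite_real_spectrum
  have hc : ∀ φ : ℝ → ℝ, ContinuousOn φ (spectrum ℝ g) := fun φ => hfin.continuousOn φ
  have h1 : g = cfc (id : ℝ → ℝ) g := (cfc_id ℝ g).symm
  conv_lhs => enter [1, 2]; rw [h1]
  rw [← cfc_mul _ _ g (hc _) (hc _), ← cfc_mul _ _ g (hc _) (hc _), ← cfc_one ℝ g]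
  apply cfc_congr
  intro t ht
  have htpos : 0 < t := by
    rw [hg.isHermitian.spectrum_real_eq_range_eigenvalues] at ht
    obtain ⟨i, rfl⟩ := ht
    exact hg.eigenvalues_pos i
  have hs : 0 < √t := Real.sqrt_pos.2 htpos
  simp only [id, Pi.one_apply]
  field_simp
  rw [Real.sq_sqrt htpos.le]

/-- Determinant bounds for `1 - A` when the quadratic form of `A` is bounded by `c`. -/
theorem det_one_sub_bounds {A : Matrix ι ι ℝ} (hA : A.IsHermitian) {c : ℝ}
    (hc : ∀ v : ι → ℝ, |v ⬝ᵥ A *ᵥ v| ≤ c * (v ⬝ᵥ v)) :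
    |(1 - A).det| ≤ (1 + c) ^ Fintype.card ι ∧
      (c ≤ 1 → (1 - c) ^ Fintype.card ι ≤ (1 - A).det) := by
  have hB : (1 - A).IsHermitian := (Matrix.isHermitian_one).sub hA
  -- At a unit eigenvector `w` the eigenvalue of `1 - A` is `1 - w ⬝ᵥ A *ᵥ w`.
  have hev : ∀ i, |1 - hB.eigenvalues i| ≤ c := by
    intro i
    have h1 := hB.eigenvalues_eq i
    set w : ι → ℝ := ⇑(hB.eigenvectorBasis i) with hw
    have hnorm : w ⬝ᵥ w = 1 := by
      have h := (EuclideanSpace.real_norm_sq_eq (hB.eigenvectorBasis i)).symm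
      rw [hB.eigenvectorBasis.orthonormal.1 i] at h
      simpa [dotProduct, sq] using h
    have h2 : hB.eigenvalues i = 1 - w ⬝ᵥ A *ᵥ w := by
      rw [h1, Matrix.sub_mulVec, Matrix.one_mulVec]
      simp [dotProduct_sub, hnorm]
    rw [h2, sub_sub_cancel]
    simpa [hnorm] using hc w
  have hdet : (1 - A).det = ∏ i, hB.eigenvalues i := by
    simpa using hB.det_eq_prod_eigenvalues
  constructor
  · rw [hdet, Finset.abs_prod]
    calc ∏ i, |hB.eigenvalues i| ≤ ∏ _i : ι, (1 + c) :=
          Finset.prod_le_prod (fun _ _ => abs_nonneg _) fun i _ => by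
            have := abs_le.1 (hev i)
            exact abs_le.2 ⟨by linarith, by linarith⟩
      _ = _ := by simp
  · intro h
    rw [hdet]
    calc (1 - c) ^ Fintype.card ι = ∏ _i : ι, (1 - c) := by simp
      _ ≤ _ := Finset.prod_le_prod (fun _ _ => by linarith) fun i _ => by
            have := abs_le.1 (hev i)
            linarith

/-- If the form of a matrix is bounded by `1` and attains it, then `1 - A` is singular. -/
theorem det_one_sub_eq_zero {A : Matrix ι ι ℝ} (hA : A.IsHermitian)
    (hle : ∀ v : ι → ℝ, v ⬝ᵥ A *ᵥ v ≤ v ⬝ᵥ v) {w : ι → ℝ} (hw : w ≠ 0)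
    (heq : w ⬝ᵥ A *ᵥ w = w ⬝ᵥ w) : (1 - A).det = 0 := by
  -- A nonsingular positive semidefinite matrix is positive definite, but the form of `1 - A`
  -- vanishes at `w`.
  by_contra hdet
  have hB : (1 - A).PosSemidef := by
    refine .of_dotProduct_mulVec_nonneg ((Matrix.isHermitian_one).sub hA) fun x => ?_
    simpa [Matrix.sub_mulVec, dotProduct_sub] using hle x
  have := (hB.posDef_iff_det_ne_zero.2 hdet).dotProduct_mulVec_pos hw
  simp [Matrix.sub_mulVec, dotProduct_sub, heq] at this

end LinearAlgebra

/-! ### Derivatives in charts and changes of chart -/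

section Charts

variable {V : Type*} [NormedAddCommGroup V] [NormedSpace ℝ V]
  {E' : Type*} [NormedAddCommGroup E'] [NormedSpace ℝ E']
  {H : Type*} [TopologicalSpace H] {I : ModelWithCorners ℝ V H}
  {M : Type*} [TopologicalSpace M] [ChartedSpace H M]
  {e e' : OpenPartialHomeomorph M H} {x : M}

theorem contDiffWithinAt_comp_extend_symm {g : M → E'}
    (he : e ∈ IsManifold.maximalAtlas I ∞ M) (hx : x ∈ e.source)
    (hg : ContMDiffAt I 𝓘(ℝ, E') ∞ g x) :
    ContDiffWithinAt ℝ ∞ (fun y => g ((e.extend I).symm y)) (Set.range I) (e.extend I x) := by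
  rw [← contMDiffWithinAt_univ, contMDiffWithinAt_iff_source_of_mem_maximalAtlas he hx] at hg
  rw [Set.preimage_univ, Set.univ_inter] at hg
  exact hg.contDiffWithinAt

theorem contDiffWithinAt_transition (he : e ∈ IsManifold.maximalAtlas I ∞ M)
    (he' : e' ∈ IsManifold.maximalAtlas I ∞ M) (hx : x ∈ e.source) (hx' : x ∈ e'.source) :
    ContDiffWithinAt ℝ ∞ (fun y => e'.extend I ((e.extend I).symm y)) (Set.range I)
      (e.extend I x) :=
  contDiffWithinAt_comp_extend_symm he hx (e'.contMDiffAt_extend he' hx')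

omit [ChartedSpace H M] in
theorem uniqueDiffWithinAt_extend (e : OpenPartialHomeomorph M H) (x : M) :
    UniqueDiffWithinAt ℝ (Set.range I) (e.extend I x) :=
  I.uniqueDiffOn _ (by simp [OpenPartialHomeomorph.extend])

omit [ChartedSpace H M] in
theorem tendsto_extend_symm (hx : x ∈ e.source) :
    Filter.Tendsto (e.extend I).symm (nhdsWithin (e.extend I x) (Set.range I)) (nhds x) := by
  have h := (e.continuousAt_extend_symm (I := I) hx).tendsto
  rw [e.extend_left_inv hx] at h
  exact h.mono_left nhdsWithin_le_nhds

/-- The chain rule for a change of chart. -/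
theorem fderivWithin_extend_symm_change {g : M → E'} (he : e ∈ IsManifold.maximalAtlas I ∞ M)
    (he' : e' ∈ IsManifold.maximalAtlas I ∞ M) (hx : x ∈ e.source) (hx' : x ∈ e'.source)
    (hg : ContMDiffAt I 𝓘(ℝ, E') ∞ g x) :
    fderivWithin ℝ (fun y => g ((e.extend I).symm y)) (Set.range I) (e.extend I x) =
      (fderivWithin ℝ (fun y => g ((e'.extend I).symm y)) (Set.range I) (e'.extend I x)).comp
        (fderivWithin ℝ (fun y => e'.extend I ((e.extend I).symm y)) (Set.range I)
          (e.extend I x)) := by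
  have h1 := (contDiffWithinAt_comp_extend_symm he' hx' hg).differentiableWithinAt (by simp)
  have h2 := (contDiffWithinAt_transition he he' hx hx').differentiableWithinAt (by simp)
  have hcoord : e'.extend I ((e.extend I).symm (e.extend I x)) = e'.extend I x := by
    rw [e.extend_left_inv hx]
  rw [← hcoord] at h1
  have h3 := fderivWithin_comp (e.extend I x) h1 h2
    (fun y _ => by simp [OpenPartialHomeomorph.extend]) (uniqueDiffWithinAt_extend e x)
  rw [hcoord] at h3
  rw [← h3]
  refine Filter.EventuallyEq.fderivWithin_eq ?_ ?_
  · filter_upwards [tendsto_extend_symm (I := I) hx (e'.open_source.mem_nhds hx')] with y hy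
    simp only [Function.comp_apply]
    rw [e'.extend_left_inv hy]
  · simp only [Function.comp_apply]
    rw [e.extend_left_inv hx, e'.extend_left_inv hx']

/-- This is the chain rule applied to the chart `e` itself, which is the identity in its own
coordinates. -/
theorem fderivWithin_transition_comp (he : e ∈ IsManifold.maximalAtlas I ∞ M)
    (he' : e' ∈ IsManifold.maximalAtlas I ∞ M) (hx : x ∈ e.source) (hx' : x ∈ e'.source) (w : V) :
    fderivWithin ℝ (fun y => e.extend I ((e'.extend I).symm y)) (Set.range I) (e'.extend I x)
      (fderivWithin ℝ (fun y => e'.extend I ((e.extend I).symm y)) (Set.range I)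
          (e.extend I x) w) = w := by
  have h := fderivWithin_extend_symm_change he he' hx hx' (e.contMDiffAt_extend he hx)
  have h2 : fderivWithin ℝ (fun y => e.extend I ((e.extend I).symm y)) (Set.range I)
      (e.extend I x) = ContinuousLinearMap.id ℝ V := by
    rw [← fderivWithin_id (uniqueDiffWithinAt_extend (I := I) e x)]
    refine Filter.EventuallyEq.fderivWithin_eq ?_ ?_
    · filter_upwards [e.extend_target_mem_nhdsWithin hx] with y hy
      exact (e.extend I).right_inv hy
    · rw [e.extend_left_inv hx, id]
  rw [h2] at h
  exact (DFunLike.congr_fun h w).symm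

theorem mfderiv_eq_fderivWithin_chartAt {g : M → E'} (hg : MDifferentiableAt I 𝓘(ℝ, E') g x) :
    mfderiv I 𝓘(ℝ, E') g x =
      fderivWithin ℝ (fun y => g (((chartAt H x).extend I).symm y)) (Set.range I)
        ((chartAt H x).extend I x) := by
  simp only [mfderiv, hg]
  rfl

end Charts

/-! ### First and second differentials of the embedding; the Weingarten equation -/

section Submanifold

variable {d k : ℕ} {H : Type*} [TopologicalSpace H]
  {I : ModelWithCorners ℝ (EuclideanSpace ℝ (Fin d)) H}
  {M : Type*} [TopologicalSpace M] [ChartedSpace H M]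
  {f : M → EuclideanSpace ℝ (Fin (d + k))} {e e' : OpenPartialHomeomorph M H} {x : M}

/-- The differential of the embedding in a chart. -/
noncomputable def chartDeriv (I : ModelWithCorners ℝ (EuclideanSpace ℝ (Fin d)) H)
    (f : M → EuclideanSpace ℝ (Fin (d + k))) (e : OpenPartialHomeomorph M H)
    (u : EuclideanSpace ℝ (Fin d)) :
    EuclideanSpace ℝ (Fin d) →L[ℝ] EuclideanSpace ℝ (Fin (d + k)) :=
  fderivWithin ℝ (fun y => f ((e.extend I).symm y)) (Set.range I) u

/-- The second differential of the embedding in a chart. -/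
noncomputable def chartHess (I : ModelWithCorners ℝ (EuclideanSpace ℝ (Fin d)) H)
    (f : M → EuclideanSpace ℝ (Fin (d + k))) (e : OpenPartialHomeomorph M H)
    (u : EuclideanSpace ℝ (Fin d)) : EuclideanSpace ℝ (Fin d) →L[ℝ]
      EuclideanSpace ℝ (Fin d) →L[ℝ] EuclideanSpace ℝ (Fin (d + k)) :=
  fderivWithin ℝ (chartDeriv I f e) (Set.range I) u

theorem contDiffWithinAt_chartDeriv (hf : ContMDiff I 𝓘(ℝ, EuclideanSpace ℝ (Fin (d + k))) ∞ f)
    (he : e ∈ IsManifold.maximalAtlas I ∞ M) (hx : x ∈ e.source) :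
    ContDiffWithinAt ℝ ∞ (chartDeriv I f e) (Set.range I) (e.extend I x) :=
  (contDiffWithinAt_comp_extend_symm he hx (hf x)).fderivWithin_right I.uniqueDiffOn (by simp)
    (by simp [OpenPartialHomeomorph.extend])

theorem contDiffWithinAt_chartHess (hf : ContMDiff I 𝓘(ℝ, EuclideanSpace ℝ (Fin (d + k))) ∞ f)
    (he : e ∈ IsManifold.maximalAtlas I ∞ M) (hx : x ∈ e.source) :
    ContDiffWithinAt ℝ ∞ (chartHess I f e) (Set.range I) (e.extend I x) :=
  (contDiffWithinAt_chartDeriv hf he hx).fderivWithin_right I.uniqueDiffOn (by simp)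
    (by simp [OpenPartialHomeomorph.extend])

/-- Symmetry persists at boundary points because the model region lies in the closure of its
interior. -/
theorem chartHess_symm (hf : ContMDiff I 𝓘(ℝ, EuclideanSpace ℝ (Fin (d + k))) ∞ f)
    (he : e ∈ IsManifold.maximalAtlas I ∞ M) (hx : x ∈ e.source)
    (v w : EuclideanSpace ℝ (Fin d)) :
    chartHess I f e (e.extend I x) v w = chartHess I f e (e.extend I x) w v := by
  have hmem : e.extend I x ∈ Set.range I := by simp [OpenPartialHomeomorph.extend]
  have h := (contDiffWithinAt_comp_extend_symm he hx (hf x)).isSymmSndFDerivWithinAt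
    (by rw [minSmoothness_of_isRCLikeNormedField]; exact ENat.LEInfty.out) I.uniqueDiffOn
    (I.range_subset_closure_interior hmem) hmem
  exact h v w

theorem fderivWithin_chartDeriv_apply
    (hf : ContMDiff I 𝓘(ℝ, EuclideanSpace ℝ (Fin (d + k))) ∞ f)
    (he : e ∈ IsManifold.maximalAtlas I ∞ M) (hx : x ∈ e.source)
    (v w : EuclideanSpace ℝ (Fin d)) :
    fderivWithin ℝ (fun y => chartDeriv I f e y w) (Set.range I) (e.extend I x) v =
      chartHess I f e (e.extend I x) v w := by
  have h := ((contDiffWithinAt_chartDeriv hf he hx).differentiableWithinAt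
    (by simp)).hasFDerivWithinAt.clm_apply (hasFDerivWithinAt_const w _ _)
  rw [h.fderivWithin (uniqueDiffWithinAt_extend e x)]
  simp [chartHess]

theorem differential_eq (hf : ContMDiff I 𝓘(ℝ, EuclideanSpace ℝ (Fin (d + k))) ∞ f) (x : M) :
    differential I f x = chartDeriv I f (chartAt H x) ((chartAt H x).extend I x) :=
  mfderiv_eq_fderivWithin_chartAt ((hf x).mdifferentiableAt (by simp))

variable [IsManifold I ∞ M]

theorem range_chartDeriv (hf : ContMDiff I 𝓘(ℝ, EuclideanSpace ℝ (Fin (d + k))) ∞ f)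
    (he : e ∈ IsManifold.maximalAtlas I ∞ M) (hx : x ∈ e.source) :
    (chartDeriv I f e (e.extend I x)).range = tangentSubspace I f x := by
  have hc := IsManifold.chart_mem_maximalAtlas (I := I) (n := ∞) x
  have hcx := mem_chart_source H x
  rw [tangentSubspace, differential_eq hf x]
  apply le_antisymm
  · rintro _ ⟨w, rfl⟩
    have h := fderivWithin_extend_symm_change he hc hx hcx (hf x)
    exact ⟨_, (DFunLike.congr_fun h w).symm⟩
  · rintro _ ⟨w, rfl⟩
    have h := fderivWithin_extend_symm_change hc he hcx hx (hf x)
    exact ⟨_, (DFunLike.congr_fun h w).symm⟩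

theorem chartDeriv_injective (hf : IsEmbeddedSubmanifold I f)
    (he : e ∈ IsManifold.maximalAtlas I ∞ M) (hx : x ∈ e.source) :
    Function.Injective (chartDeriv I f e (e.extend I x)) := by
  have hc := IsManifold.chart_mem_maximalAtlas (I := I) (n := ∞) x
  have hcx := mem_chart_source H x
  have hinj : Function.Injective (chartDeriv I f (chartAt H x) ((chartAt H x).extend I x)) := by
    rw [← differential_eq hf.contMDiff x]
    exact hf.injective_mfderiv x
  have h : chartDeriv I f e (e.extend I x) = (chartDeriv I f (chartAt H x) _).comp _ :=
    fderivWithin_extend_symm_change he hc hx hcx (hf.contMDiff x)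
  rw [h]
  exact hinj.comp
    (Function.LeftInverse.injective (fderivWithin_transition_comp he hc hx hcx))

theorem inner_chartDeriv_eq_zero (hf : ContMDiff I 𝓘(ℝ, EuclideanSpace ℝ (Fin (d + k))) ∞ f)
    (he : e ∈ IsManifold.maximalAtlas I ∞ M) (hx : x ∈ e.source)
    {ν : EuclideanSpace ℝ (Fin (d + k))} (hν : ν ∈ normalSubspace I f x)
    (w : EuclideanSpace ℝ (Fin d)) : inner ℝ ν (chartDeriv I f e (e.extend I x) w) = 0 := by
  refine Submodule.inner_left_of_mem_orthogonal (K := tangentSubspace I f x) ?_ hν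
  rw [← range_chartDeriv hf he hx]
  exact ⟨w, rfl⟩

/-- The Weingarten equation: the second differential against a normal field. -/
theorem inner_fderivWithin_normal_field
    (hf : ContMDiff I 𝓘(ℝ, EuclideanSpace ℝ (Fin (d + k))) ∞ f)
    (he : e ∈ IsManifold.maximalAtlas I ∞ M) (hx : x ∈ e.source)
    {η : M → EuclideanSpace ℝ (Fin (d + k))}
    (hη : ContMDiffAt I 𝓘(ℝ, EuclideanSpace ℝ (Fin (d + k))) ∞ η x)
    (hn : ∀ᶠ y in nhds x, η y ∈ normalSubspace I f y) (v w : EuclideanSpace ℝ (Fin d)) :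
    inner ℝ (fderivWithin ℝ (fun y => η ((e.extend I).symm y)) (Set.range I) (e.extend I x) v)
      (chartDeriv I f e (e.extend I x) w) =
    - inner ℝ (η x) (chartHess I f e (e.extend I x) v w) := by
  have hu := uniqueDiffWithinAt_extend (I := I) e x
  have h1 := ((contDiffWithinAt_comp_extend_symm he hx hη).differentiableWithinAt
    (by simp)).hasFDerivWithinAt
  have h2 := ((contDiffWithinAt_chartDeriv hf he hx).differentiableWithinAt
    (by simp)).hasFDerivWithinAt.clm_apply (hasFDerivWithinAt_const w _ _)
  have h3 := h1.inner ℝ h2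
  -- A normal field is orthogonal to `chartDeriv I f e y w` for all nearby `y`; differentiating this
  -- identity in the direction `v` gives the equation.
  have h4 : (fun y => inner ℝ (η ((e.extend I).symm y)) (chartDeriv I f e y w))
      =ᶠ[nhdsWithin (e.extend I x) (Set.range I)] fun _ => (0 : ℝ) := by
    filter_upwards [tendsto_extend_symm (I := I) hx (hn.and (e.open_source.mem_nhds hx)),
      e.extend_target_mem_nhdsWithin hx] with y hy hyt
    have := inner_chartDeriv_eq_zero hf he hy.2 hy.1 w
    rwa [(e.extend I).right_inv hyt] at this
  have h5 : fderivWithin ℝ (fun y => inner ℝ (η ((e.extend I).symm y)) (chartDeriv I f e y w))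
      (Set.range I) (e.extend I x) = 0 := by
    have hmem : e.extend I x ∈ Set.range I := by simp [OpenPartialHomeomorph.extend]
    rw [h4.fderivWithin_eq (h4.eq_of_nhdsWithin hmem), fderivWithin_fun_const]
    rfl
  rw [h3.fderivWithin hu] at h5
  replace h5 := DFunLike.congr_fun h5 v
  rw [e.extend_left_inv hx] at h5
  simp only [ContinuousLinearMap.comp_apply, ContinuousLinearMap.prod_apply,
    ContinuousLinearMap.flip_apply, ContinuousLinearMap.comp_zero,
    zero_add, _root_.zero_apply, fderivInnerCLM_apply] at h5
  rw [chartHess]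
  linarith

end Submanifold

/-! ### Smooth dependence of Gram-Schmidt orthonormalisation -/

section GramSchmidt

open InnerProductSpace

variable {ι : Type*} [LinearOrder ι] [LocallyFiniteOrderBot ι] [WellFoundedLT ι]
  {F : Type*} [NormedAddCommGroup F] [InnerProductSpace ℝ F]
  {V : Type*} [NormedAddCommGroup V] [NormedSpace ℝ V]
  {H : Type*} [TopologicalSpace H] {I : ModelWithCorners ℝ V H}
  {M : Type*} [TopologicalSpace M] [ChartedSpace H M]

theorem contMDiffOn_inner {U : Set M} {a b : M → F} (ha : ContMDiffOn I 𝓘(ℝ, F) ∞ a U)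
    (hb : ContMDiffOn I 𝓘(ℝ, F) ∞ b U) :
    ContMDiffOn I 𝓘(ℝ, ℝ) ∞ (fun x => inner ℝ (a x) (b x)) U :=
  (contDiff_inner (𝕜 := ℝ) (E := F) (n := ∞)).contMDiff.comp_contMDiffOn
    (ha.prodMk_space hb)

/-- Each step of the recursion divides only by squared norms of earlier vectors, which are nonzero
by linear independence. -/
theorem contMDiffOn_gramSchmidt {U : Set M} {v : ι → M → F}
    (hv : ∀ i, ContMDiffOn I 𝓘(ℝ, F) ∞ (v i) U)
    (hli : ∀ x ∈ U, LinearIndependent ℝ fun i => v i x) (i : ι) :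
    ContMDiffOn I 𝓘(ℝ, F) ∞ (fun x => gramSchmidt ℝ (fun j => v j x) i) U := by
  induction i using WellFoundedLT.induction with
  | ind i ih =>
    have hdef : (fun x => gramSchmidt ℝ (fun j => v j x) i) = fun x => v i x -
        ∑ j ∈ Finset.Iio i, (inner ℝ (gramSchmidt ℝ (fun j => v j x) j) (v i x) /
          ‖gramSchmidt ℝ (fun j => v j x) j‖ ^ 2) • gramSchmidt ℝ (fun j => v j x) j := by
      funext x
      rw [gramSchmidt_def]
      simp_rw [Submodule.starProjection_singleton]
      rfl
    rw [hdef]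
    refine (hv i).sub (contMDiffOn_finsetSum fun j hj => ?_)
    have hj' := ih j (Finset.mem_Iio.1 hj)
    have hnorm : ContMDiffOn I 𝓘(ℝ, ℝ) ∞
        (fun x => ‖gramSchmidt ℝ (fun j => v j x) j‖ ^ 2) U := by
      simp_rw [← real_inner_self_eq_norm_sq]
      exact contMDiffOn_inner hj' hj'
    have hcoef : ContMDiffOn I 𝓘(ℝ, ℝ) ∞ (fun x =>
        inner ℝ (gramSchmidt ℝ (fun j => v j x) j) (v i x) /
        ‖gramSchmidt ℝ (fun j => v j x) j‖ ^ 2) U := by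
      refine ContMDiffOn.div₀ (contMDiffOn_inner hj' (hv i)) hnorm fun x hx => ?_
      have := gramSchmidt_ne_zero (𝕜 := ℝ) j (hli x hx)
      simpa using this
    exact hcoef.smul hj'

theorem contMDiffOn_gramSchmidtNormed {U : Set M} {v : ι → M → F}
    (hv : ∀ i, ContMDiffOn I 𝓘(ℝ, F) ∞ (v i) U)
    (hli : ∀ x ∈ U, LinearIndependent ℝ fun i => v i x) (i : ι) :
    ContMDiffOn I 𝓘(ℝ, F) ∞ (fun x => gramSchmidtNormed ℝ (fun j => v j x) i) U := by
  have h := contMDiffOn_gramSchmidt hv hli i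
  intro x hx
  have hne := gramSchmidt_ne_zero (𝕜 := ℝ) i (hli x hx)
  have hn : ContMDiffWithinAt I 𝓘(ℝ, ℝ) ∞ (fun x => ‖gramSchmidt ℝ (fun j => v j x) i‖) U x :=
    (contDiffAt_norm ℝ hne).contMDiffAt.comp_contMDiffWithinAt x (h x hx)
  exact (hn.inv₀ (by simpa using hne)).smul (h x hx)

end GramSchmidt

/-! ### Existence of smooth orthonormal normal frames -/

section Frame

variable {d k : ℕ} {H : Type*} [TopologicalSpace H]
  {I : ModelWithCorners ℝ (EuclideanSpace ℝ (Fin d)) H}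
  {M : Type*} [TopologicalSpace M] [ChartedSpace H M] [IsManifold I ∞ M]
  {f : M → EuclideanSpace ℝ (Fin (d + k))} {e : OpenPartialHomeomorph M H} {x : M}

omit [IsManifold I ∞ M] in
theorem finrank_normalSubspace (hf : IsEmbeddedSubmanifold I f) (x : M) :
    Module.finrank ℝ (normalSubspace I f x) = k := by
  have h1 : Module.finrank ℝ (tangentSubspace I f x) = d := by
    have := LinearMap.finrank_range_of_inj (f := (differential I f x).toLinearMap)
      (hf.injective_mfderiv x)
    exact this.trans finrank_euclideanSpace_fin
  have h2 := (tangentSubspace I f x).finrank_add_finrank_orthogonal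
  rw [h1, finrank_euclideanSpace_fin] at h2
  exact Nat.add_left_cancel h2

omit [TopologicalSpace H] [TopologicalSpace M] [ChartedSpace H M] [IsManifold I ∞ M] in
theorem eq_sum_single (w : EuclideanSpace ℝ (Fin d)) :
    w = ∑ i, w i • EuclideanSpace.single i (1 : ℝ) := by
  ext j
  simp [Finset.sum_apply, Pi.single_apply]

theorem mem_normalSubspace_iff (hf : ContMDiff I 𝓘(ℝ, EuclideanSpace ℝ (Fin (d + k))) ∞ f)
    (he : e ∈ IsManifold.maximalAtlas I ∞ M) (hx : x ∈ e.source)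
    {ν : EuclideanSpace ℝ (Fin (d + k))} : ν ∈ normalSubspace I f x ↔
      ∀ i, inner ℝ ν (chartDeriv I f e (e.extend I x) (EuclideanSpace.single i 1)) = 0 := by
  refine ⟨fun h i => inner_chartDeriv_eq_zero hf he hx h _, fun h => ?_⟩
  rw [normalSubspace, ← range_chartDeriv hf he hx, Submodule.mem_orthogonal']
  rintro _ ⟨w, rfl⟩
  change inner ℝ ν (chartDeriv I f e (e.extend I x) w) = 0
  rw [eq_sum_single w, map_sum, inner_sum]
  exact Finset.sum_eq_zero fun i _ => by rw [map_smul, real_inner_smul_right, h, mul_zero]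

theorem linearIndependent_chartDeriv (hf : IsEmbeddedSubmanifold I f)
    (he : e ∈ IsManifold.maximalAtlas I ∞ M) (hx : x ∈ e.source) :
    LinearIndependent ℝ
      fun i => chartDeriv I f e (e.extend I x) (EuclideanSpace.single i (1 : ℝ)) := by
  have h := (EuclideanSpace.basisFun (Fin d) ℝ).toBasis.linearIndependent.map'
    (chartDeriv I f e (e.extend I x)).toLinearMap
    (LinearMap.ker_eq_bot.2 (chartDeriv_injective hf he hx))
  have h2 : (fun i => chartDeriv I f e (e.extend I x) (EuclideanSpace.single i (1 : ℝ))) =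
      (chartDeriv I f e (e.extend I x)).toLinearMap ∘
        (EuclideanSpace.basisFun (Fin d) ℝ).toBasis := by
    ext1 i
    simp
  rw [h2]
  exact h

omit [IsManifold I ∞ M] in
theorem contMDiffOn_chartDeriv (hf : ContMDiff I 𝓘(ℝ, EuclideanSpace ℝ (Fin (d + k))) ∞ f)
    (he : e ∈ IsManifold.maximalAtlas I ∞ M) (w : EuclideanSpace ℝ (Fin d)) :
    ContMDiffOn I 𝓘(ℝ, EuclideanSpace ℝ (Fin (d + k))) ∞
      (fun y => chartDeriv I f e (e.extend I y) w) e.source := by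
  intro y hy
  have h1 : ContDiffWithinAt ℝ ∞ (fun u => chartDeriv I f e u w) (Set.range I) (e.extend I y) :=
    (contDiffWithinAt_chartDeriv hf he hy).clm_apply contDiffWithinAt_const
  exact h1.contMDiffWithinAt.comp y (e.contMDiffOn_extend he y hy)
    fun z _ => by simp [OpenPartialHomeomorph.extend]

/-- Local coordinates with a smooth orthonormal normal frame exist around every point. -/
theorem exists_bundleCoords (hf : IsEmbeddedSubmanifold I f) (x₀ : M) :
    ∃ c : BundleCoords I f, x₀ ∈ c.chart.source := by
  classical
  set e := chartAt H x₀ with he_def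
  have he : e ∈ IsManifold.maximalAtlas I ∞ M := IsManifold.chart_mem_maximalAtlas x₀
  have hx₀ : x₀ ∈ e.source := mem_chart_source H x₀
  let b : OrthonormalBasis (Fin k) ℝ (normalSubspace I f x₀) :=
    (stdOrthonormalBasis ℝ _).reindex (finCongr (finrank_normalSubspace hf x₀))
  -- The coordinate tangent vectors come first, followed by a basis of the normal space at `x₀` held
  -- constant. The last `k` vectors produced by Gram-Schmidt are then orthogonal to the tangent
  -- space at every nearby point.
  let v : Fin (d + k) → M → EuclideanSpace ℝ (Fin (d + k)) := fun j y =>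
    Sum.elim (fun i => chartDeriv I f e (e.extend I y) (EuclideanSpace.single i (1 : ℝ)))
      (fun α => (b α : EuclideanSpace ℝ (Fin (d + k)))) (finSumFinEquiv.symm j)
  have hv : ∀ j, ContMDiffOn I 𝓘(ℝ, EuclideanSpace ℝ (Fin (d + k))) ∞ (v j) e.source := by
    intro j
    rcases hj : finSumFinEquiv.symm j with i | α
    · simpa [v, hj] using contMDiffOn_chartDeriv hf.contMDiff he (EuclideanSpace.single i 1)
    · simpa [v, hj] using contMDiffOn_const
  have hli₀ : LinearIndependent ℝ fun j => v j x₀ := by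
    have h : LinearIndependent ℝ (Sum.elim
        (fun i => chartDeriv I f e (e.extend I x₀) (EuclideanSpace.single i (1 : ℝ)))
        (fun α => (b α : EuclideanSpace ℝ (Fin (d + k))))) := by
      refine (linearIndependent_chartDeriv hf he hx₀).sum_type
        (b.orthonormal.comp_linearIsometry (normalSubspace I f x₀).subtypeₗᵢ).linearIndependent
        ((tangentSubspace I f x₀).orthogonal_disjoint.mono ?_ ?_) <;>
      rw [Submodule.span_le, Set.range_subset_iff] <;> intro i
      · rw [← range_chartDeriv hf.contMDiff he hx₀]
        exact ⟨_, rfl⟩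
      · exact (b i).2
    exact h.comp _ finSumFinEquiv.symm.injective
  -- Independence is an open condition, so shrinking the chart domain preserves it.
  have hU : IsOpen (e.source ∩ {y | LinearIndependent ℝ fun j => v j y}) := by
    have hc : ContinuousOn (fun y j => v j y) e.source :=
      continuousOn_pi.2 fun j => (hv j).continuousOn
    exact hc.isOpen_inter_preimage e.open_source isOpen_setOfPred_linearIndependent
  set U := e.source ∩ {y | LinearIndependent ℝ fun j => v j y} with hUdef
  have hsrc : (e.restr U).source = U := by
    rw [e.restr_source' U hU]
    exact Set.inter_eq_right.2 Set.inter_subset_left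
  refine ⟨⟨e.restr U, restr_mem_maximalAtlas _ he hU,
    fun α y => InnerProductSpace.gramSchmidtNormed ℝ (fun j => v j y) (Fin.natAdd d α),
    fun α => ?_, fun α y hy => ?_, fun y hy => ?_⟩, ?_⟩
  · rw [hsrc]
    exact contMDiffOn_gramSchmidtNormed (fun j => (hv j).mono Set.inter_subset_left)
      (fun y hy => hy.2) _
  · rw [hsrc] at hy
    rw [mem_normalSubspace_iff hf.contMDiff he hy.1]
    intro i
    have h := InnerProductSpace.gramSchmidt_inv_triangular ℝ (fun j => v j y)
      (i := Fin.castAdd k i) (j := Fin.natAdd d α) (by simp [Fin.lt_def]; omega)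
    have hvi : v (Fin.castAdd k i) y =
        chartDeriv I f e (e.extend I y) (EuclideanSpace.single i (1 : ℝ)) := by
      simp [v]
    rw [← hvi, InnerProductSpace.gramSchmidtNormed, real_inner_smul_left, h, mul_zero]
  · rw [hsrc] at hy
    exact (InnerProductSpace.gramSchmidtNormed_orthonormal hy.2).comp _
      (Fin.natAdd_injective k d)
  · rw [hsrc]
    exact ⟨hx₀, hli₀⟩

end Frame

/-! ### The curvature at a point: invariance, continuity and maxima -/

section Pointwise

variable {d k : ℕ} {H : Type*} [TopologicalSpace H]
  {I : ModelWithCorners ℝ (EuclideanSpace ℝ (Fin d)) H}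
  {M : Type*} [TopologicalSpace M] [ChartedSpace H M]
  {f : M → EuclideanSpace ℝ (Fin (d + k))} {e e' : OpenPartialHomeomorph M H} {x : M}

theorem dotProduct_mulVec_inner_bilin {F : Type*} [NormedAddCommGroup F] [InnerProductSpace ℝ F]
    (B : EuclideanSpace ℝ (Fin d) →L[ℝ] EuclideanSpace ℝ (Fin d) →L[ℝ] F) (ν : F)
    (v w : EuclideanSpace ℝ (Fin d)) :
    v.ofLp ⬝ᵥ (Matrix.of fun i j => inner ℝ ν (B (EuclideanSpace.single i 1)
      (EuclideanSpace.single j 1))) *ᵥ w.ofLp = inner ℝ ν (B v w) := by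
  conv_rhs => rw [eq_sum_single v, eq_sum_single w]
  simp only [map_sum, map_smul, _root_.sum_apply, _root_.smul_apply, inner_sum,
    real_inner_smul_right, mulVec, dotProduct, Finset.mul_sum, Matrix.of_apply]
  rw [Finset.sum_comm]
  exact Finset.sum_congr rfl fun i _ => Finset.sum_congr rfl fun j _ => by ring

/-- The second fundamental form `II(w, w)` in a chart. -/
noncomputable def curvatureVec (I : ModelWithCorners ℝ (EuclideanSpace ℝ (Fin d)) H)
    (f : M → EuclideanSpace ℝ (Fin (d + k))) (e : OpenPartialHomeomorph M H) (x : M)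
    (w : EuclideanSpace ℝ (Fin d)) : EuclideanSpace ℝ (Fin (d + k)) :=
  (normalSubspace I f x).starProjection (chartHess I f e (e.extend I x) w w)

theorem curvatureVec_smul (s : ℝ) (w : EuclideanSpace ℝ (Fin d)) :
    curvatureVec I f e x (s • w) = s ^ 2 • curvatureVec I f e x w := by
  simp only [curvatureVec, map_smul, _root_.smul_apply, smul_smul, sq]

theorem curvatureVec_mem (w : EuclideanSpace ℝ (Fin d)) :
    curvatureVec I f e x w ∈ normalSubspace I f x :=
  Submodule.starProjection_apply_mem _ _

theorem inner_starProjection_normal {ν z : EuclideanSpace ℝ (Fin (d + k))}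
    (hν : ν ∈ normalSubspace I f x) :
    inner ℝ ν ((normalSubspace I f x).starProjection z) = inner ℝ ν z := by
  rw [← Submodule.inner_starProjection_left_eq_right, Submodule.starProjection_eq_self_iff.2 hν]

namespace BundleCoords

variable (c : BundleCoords I f)

theorem point_coord (hx : x ∈ c.chart.source) : c.point (c.coord x) = x :=
  c.chart.extend_left_inv hx

theorem shapeMatrix_coord (hf : ContMDiff I 𝓘(ℝ, EuclideanSpace ℝ (Fin (d + k))) ∞ f)
    (hx : x ∈ c.chart.source) (α : Fin k) :
    c.shapeMatrix α (c.coord x) = Matrix.of fun i j => inner ℝ (c.frame α x)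
      (chartHess I f c.chart (c.coord x) (EuclideanSpace.single i 1)
        (EuclideanSpace.single j 1)) := by
  ext i j
  simp only [shapeMatrix, Matrix.of_apply, secondFundamentalForm]
  have hp := c.point_coord hx
  rw [inner_starProjection_normal (c.frame_normal α _ (by rwa [hp])), hp]
  congr 1
  exact fderivWithin_chartDeriv_apply hf c.chart_mem hx _ _

theorem form_shapeMatrix (hf : ContMDiff I 𝓘(ℝ, EuclideanSpace ℝ (Fin (d + k))) ∞ f)
    (hx : x ∈ c.chart.source) (α : Fin k) (v : EuclideanSpace ℝ (Fin d)) :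
    v.ofLp ⬝ᵥ c.shapeMatrix α (c.coord x) *ᵥ v.ofLp =
      inner ℝ (c.frame α x) (curvatureVec I f c.chart x v) := by
  rw [c.shapeMatrix_coord hf hx, dotProduct_mulVec_inner_bilin, curvatureVec,
    inner_starProjection_normal (c.frame_normal α x hx)]
  rfl

theorem shapeMatrix_isHermitian (hf : ContMDiff I 𝓘(ℝ, EuclideanSpace ℝ (Fin (d + k))) ∞ f)
    (hx : x ∈ c.chart.source) (α : Fin k) : (c.shapeMatrix α (c.coord x)).IsHermitian := by
  rw [c.shapeMatrix_coord hf hx]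
  ext i j
  simp only [conjTranspose_apply, Matrix.of_apply, star_trivial]
  congr 1
  exact chartHess_symm hf c.chart_mem hx _ _

theorem baseMetric_eq_gram (u : EuclideanSpace ℝ (Fin d)) :
    c.baseMetric u =
      gram ℝ fun i => chartDeriv I f c.chart u (EuclideanSpace.single i (1 : ℝ)) := rfl

theorem form_baseMetric (u v : EuclideanSpace ℝ (Fin d)) :
    v.ofLp ⬝ᵥ c.baseMetric u *ᵥ v.ofLp = ‖chartDeriv I f c.chart u v‖ ^ 2 := by
  have h := star_dotProduct_gram_mulVec (𝕜 := ℝ)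
    (fun i => chartDeriv I f c.chart u (EuclideanSpace.single i (1 : ℝ))) v.ofLp v.ofLp
  rw [star_trivial, ← c.baseMetric_eq_gram] at h
  rw [h, ← real_inner_self_eq_norm_sq]
  conv_rhs => rw [eq_sum_single v]
  simp only [map_sum, map_smul]

variable [IsManifold I ∞ M]

theorem baseMetric_posDef (hf : IsEmbeddedSubmanifold I f) (hx : x ∈ c.chart.source) :
    (c.baseMetric (c.coord x)).PosDef :=
  posDef_gram_of_linearIndependent (linearIndependent_chartDeriv hf c.chart_mem hx)

omit [IsManifold I ∞ M] in
-- Parseval: the `k` orthonormal frame vectors span the normal space, which has dimension `k`.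
theorem sum_inner_frame_sq (hf : IsEmbeddedSubmanifold I f) (hx : x ∈ c.chart.source)
    {z : EuclideanSpace ℝ (Fin (d + k))} (hz : z ∈ normalSubspace I f x) :
    ∑ α, inner ℝ (c.frame α x) z ^ 2 = ‖z‖ ^ 2 := by
  let a : Fin k → normalSubspace I f x := fun α => ⟨c.frame α x, c.frame_normal α x hx⟩
  have ha : Orthonormal ℝ a := by
    rw [← (normalSubspace I f x).subtypeₗᵢ.orthonormal_comp_iff]
    exact c.frame_orthonormal x hx
  let b : OrthonormalBasis (Fin k) ℝ (normalSubspace I f x) :=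
    OrthonormalBasis.mk ha
      (ha.linearIndependent.span_eq_top_of_card_eq_finrank' (by
        rw [finrank_normalSubspace hf x, Fintype.card_fin])).ge
  have h := b.sum_sq_inner_right ⟨z, hz⟩
  simpa [b, a] using h

omit [IsManifold I ∞ M] in
theorem baseMetricInvSqrt_isHermitian (u : EuclideanSpace ℝ (Fin d)) :
    (c.baseMetricInvSqrt u).IsHermitian := invSqrt_isHermitian _

/-- `g_B^{-1/2}` applied to a vector. -/
noncomputable def normalize (u v : EuclideanSpace ℝ (Fin d)) : EuclideanSpace ℝ (Fin d) :=
  WithLp.toLp 2 (c.baseMetricInvSqrt u *ᵥ v.ofLp)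

omit [ChartedSpace H M] [IsManifold I ∞ M] in
theorem dotProduct_conj_mulVec {R A : Matrix (Fin d) (Fin d) ℝ} (hR : R.IsHermitian)
    (v : Fin d → ℝ) : v ⬝ᵥ (R * A * R) *ᵥ v = (R *ᵥ v) ⬝ᵥ A *ᵥ (R *ᵥ v) := by
  have hT : Rᵀ = R := by rwa [IsHermitian, conjTranspose_eq_transpose_of_trivial] at hR
  rw [← mulVec_mulVec, ← mulVec_mulVec, dotProduct_mulVec, ← mulVec_transpose, hT]

/-- The factor $g_B^{-1/2}$ exchanges the Euclidean unit sphere of coordinate vectors for the unit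
sphere of the tangent space. -/
theorem norm_chartDeriv_normalize (hf : IsEmbeddedSubmanifold I f) (hx : x ∈ c.chart.source)
    (v : EuclideanSpace ℝ (Fin d)) :
    ‖chartDeriv I f c.chart (c.coord x) (c.normalize (c.coord x) v)‖ = ‖v‖ := by
  have h := c.form_baseMetric (c.coord x) (c.normalize (c.coord x) v)
  have h2 := dotProduct_conj_mulVec (A := c.baseMetric (c.coord x))
    (invSqrt_isHermitian (c.baseMetric (c.coord x))) v.ofLp
  rw [invSqrt_mul_mul_invSqrt (c.baseMetric_posDef hf hx), one_mulVec] at h2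
  have h3 : ‖v‖ ^ 2 = v.ofLp ⬝ᵥ v.ofLp := by
    rw [EuclideanSpace.real_norm_sq_eq]
    simp [dotProduct, sq]
  have h4 : ‖chartDeriv I f c.chart (c.coord x) (c.normalize (c.coord x) v)‖ ^ 2 = ‖v‖ ^ 2 := by
    rw [← h, h3, h2]
    rfl
  exact (sq_eq_sq₀ (norm_nonneg _) (norm_nonneg _)).1 h4

theorem normalize_surjective (hf : IsEmbeddedSubmanifold I f) (hx : x ∈ c.chart.source) :
    Function.Surjective (c.normalize (c.coord x)) := by
  intro w
  have h := invSqrt_mul_mul_invSqrt (c.baseMetric_posDef hf hx)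
  rw [mul_eq_one_comm] at h
  refine ⟨WithLp.toLp 2 ((c.baseMetricInvSqrt (c.coord x) * c.baseMetric (c.coord x)) *ᵥ w.ofLp),
    ?_⟩
  rw [normalize]
  simp only [mulVec_mulVec]
  rw [baseMetricInvSqrt, h, one_mulVec]

omit [IsManifold I ∞ M] in
theorem curvatureIn_coord (hf : IsEmbeddedSubmanifold I f) (hx : x ∈ c.chart.source)
    (v : EuclideanSpace ℝ (Fin d)) :
    c.curvatureIn (c.coord x) v =
      ‖curvatureVec I f c.chart x (c.normalize (c.coord x) v)‖ := by
  rw [curvatureIn, Real.sqrt_eq_iff_eq_sq (Finset.sum_nonneg fun _ _ => sq_nonneg _)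
    (norm_nonneg _), ← c.sum_inner_frame_sq hf hx (curvatureVec_mem _)]
  refine Finset.sum_congr rfl fun α _ => ?_
  rw [dotProduct_conj_mulVec (c.baseMetricInvSqrt_isHermitian _)]
  rw [← c.form_shapeMatrix hf.contMDiff hx]
  rfl

/-- The curvatures in given coordinates, as a set of values over the unit tangent vectors. -/
theorem curvature_set_eq (hf : IsEmbeddedSubmanifold I f) (hx : x ∈ c.chart.source) :
    {t | ∃ v : EuclideanSpace ℝ (Fin d), ‖v‖ = 1 ∧ t = c.curvatureIn (c.coord x) v} =
      {t | ∃ w, ‖chartDeriv I f c.chart (c.coord x) w‖ = 1 ∧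
        t = ‖curvatureVec I f c.chart x w‖} := by
  ext t
  constructor
  · rintro ⟨v, hv, rfl⟩
    exact ⟨_, (c.norm_chartDeriv_normalize hf hx v).trans hv, c.curvatureIn_coord hf hx v⟩
  · rintro ⟨w, hw, rfl⟩
    obtain ⟨v, rfl⟩ := c.normalize_surjective hf hx w
    exact ⟨v, (c.norm_chartDeriv_normalize hf hx v).symm.trans hw,
      (c.curvatureIn_coord hf hx v).symm⟩

/-- The unit tangent sphere varies with `x`. Since $\mathrm{II}(w,w)$ is homogeneous of degree two,
a quotient replaces it by one fixed compact sphere, as continuity in `x` requires. -/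
theorem curvature_set_eq_quotient (hf : IsEmbeddedSubmanifold I f) (hx : x ∈ c.chart.source) :
    {t | ∃ v : EuclideanSpace ℝ (Fin d), ‖v‖ = 1 ∧ t = c.curvatureIn (c.coord x) v} =
      Set.range fun w : Metric.sphere (0 : EuclideanSpace ℝ (Fin d)) 1 =>
        ‖curvatureVec I f c.chart x w‖ / ‖chartDeriv I f c.chart (c.coord x) w‖ ^ 2 := by
  have hpos : ∀ w : EuclideanSpace ℝ (Fin d), w ≠ 0 →
      0 < ‖chartDeriv I f c.chart (c.coord x) w‖ := fun w hw =>
    norm_pos_iff.2 fun h => hw (chartDeriv_injective hf c.chart_mem hx (h.trans (map_zero _).symm))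
  rw [c.curvature_set_eq hf hx]
  ext t
  constructor
  · rintro ⟨w, hw, rfl⟩
    have hw0 : w ≠ 0 := by
      rintro rfl
      simp at hw
    have hn := norm_pos_iff.2 hw0
    refine ⟨⟨‖w‖⁻¹ • w, by simp [norm_smul, hn.ne']⟩, ?_⟩
    simp only [curvatureVec_smul, map_smul, norm_smul, norm_pow, norm_inv, norm_norm, hw]
    field_simp
  · rintro ⟨⟨w, hw⟩, rfl⟩
    have hw0 : w ≠ 0 := by
      rintro rfl
      simp at hw
    have hn := hpos w hw0
    refine ⟨‖chartDeriv I f c.chart (c.coord x) w‖⁻¹ • w, ?_, ?_⟩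
    · rw [map_smul, norm_smul, norm_inv, norm_norm, inv_mul_cancel₀ hn.ne']
    · rw [curvatureVec_smul, norm_smul, norm_pow, norm_inv, norm_norm]
      field_simp

/-- The right side contains only first derivatives, so a change of chart needs no second-order chain
rule. The chart `e` need not be that of `c`. -/
theorem inner_frame_curvatureVec (hf : IsEmbeddedSubmanifold I f)
    (he : e ∈ IsManifold.maximalAtlas I ∞ M) (hx : x ∈ e.source) (hxc : x ∈ c.chart.source)
    (α : Fin k) (w : EuclideanSpace ℝ (Fin d)) :
    inner ℝ (c.frame α x) (curvatureVec I f e x w) = -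
      inner ℝ (fderivWithin ℝ (fun y => c.frame α ((e.extend I).symm y)) (Set.range I)
        (e.extend I x) w) (chartDeriv I f e (e.extend I x) w) := by
  rw [curvatureVec, inner_starProjection_normal (c.frame_normal α x hxc),
    inner_fderivWithin_normal_field hf.contMDiff he hx
      ((c.frame_smooth α).contMDiffAt (c.chart.open_source.mem_nhds hxc))
      (Filter.mem_of_superset (c.chart.open_source.mem_nhds hxc) (c.frame_normal α)), neg_neg]

omit [IsManifold I ∞ M] in
theorem eq_of_inner_frame_eq (hf : IsEmbeddedSubmanifold I f) (hx : x ∈ c.chart.source)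
    {z z' : EuclideanSpace ℝ (Fin (d + k))} (hz : z ∈ normalSubspace I f x)
    (hz' : z' ∈ normalSubspace I f x)
    (h : ∀ α, inner ℝ (c.frame α x) z = inner ℝ (c.frame α x) z') : z = z' := by
  have := c.sum_inner_frame_sq hf hx (Submodule.sub_mem _ hz hz')
  simp only [inner_sub_right, h, sub_self] at this
  rw [← sub_eq_zero, ← norm_eq_zero]
  simpa using this.symm

/-- The transition differential preserves the tangent vector and the derivatives of the frame of `c`
along it, hence $\mathrm{II}(w,w)$. Testing both sides against that single frame removes the
dependence on the frame of `c'`. -/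
theorem curvature_set_subset (hf : IsEmbeddedSubmanifold I f) (c' : BundleCoords I f)
    (hx : x ∈ c.chart.source) (hx' : x ∈ c'.chart.source) :
    {t | ∃ v : EuclideanSpace ℝ (Fin d), ‖v‖ = 1 ∧ t = c.curvatureIn (c.coord x) v} ⊆
      {t | ∃ v : EuclideanSpace ℝ (Fin d), ‖v‖ = 1 ∧ t = c'.curvatureIn (c'.coord x) v} := by
  rw [c.curvature_set_eq hf hx, c'.curvature_set_eq hf hx']
  rintro _ ⟨w, hw, rfl⟩
  have h1 : ∀ {g : M → EuclideanSpace ℝ (Fin (d + k))}, ContMDiffAt I _ ∞ g x → _ := fun {g} hg =>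
    DFunLike.congr_fun
      (fderivWithin_extend_symm_change (g := g) c.chart_mem c'.chart_mem hx hx' hg) w
  have hD := h1 (hf.contMDiff x)
  refine ⟨_, (congrArg norm hD).symm.trans hw, congrArg norm ?_⟩
  refine c.eq_of_inner_frame_eq hf hx (curvatureVec_mem _)
    (curvatureVec_mem _) fun α => ?_
  rw [c.inner_frame_curvatureVec hf c.chart_mem hx hx,
    c.inner_frame_curvatureVec hf c'.chart_mem hx' hx]
  have hE := h1 ((c.frame_smooth α).contMDiffAt (c.chart.open_source.mem_nhds hx))
  exact congrArg₂ (fun a b => -inner ℝ a b) hE hD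

theorem absCurvature_eq (hf : IsEmbeddedSubmanifold I f) (hx : x ∈ c.chart.source) :
    absCurvature I f x = sSup (Set.range fun w : Metric.sphere (0 : EuclideanSpace ℝ (Fin d)) 1 =>
        ‖curvatureVec I f c.chart x w‖ / ‖chartDeriv I f c.chart (c.coord x) w‖ ^ 2) := by
  rw [← c.curvature_set_eq_quotient hf hx, absCurvature]
  congr 1
  ext t
  constructor
  · rintro ⟨c', hx', ht⟩
    exact c'.curvature_set_subset hf c hx' hx ht
  · exact fun ht => ⟨c, hx, ht⟩

/-- The Rayleigh quotient of the second fundamental form is jointly continuous. -/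
theorem continuous_quotient (hf : IsEmbeddedSubmanifold I f) :
    Continuous fun p : c.chart.source × Metric.sphere (0 : EuclideanSpace ℝ (Fin d)) 1 =>
      ‖curvatureVec I f c.chart p.1 p.2‖ /
        ‖chartDeriv I f c.chart (c.coord p.1) p.2‖ ^ 2 := by
  have hcoord : Continuous fun y : c.chart.source => c.coord (y : M) :=
    continuousOn_iff_continuous_domRestrict.1 (c.chart.continuousOn_extend (I := I) |>.mono
      (by rw [c.chart.extend_source]))
  have hcomp : ∀ {F : Type} [TopologicalSpace F] {G : EuclideanSpace ℝ (Fin d) → F},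
      (∀ y ∈ c.chart.source, ContinuousWithinAt G (Set.range I) (c.coord y)) →
      Continuous fun y : c.chart.source => G (c.coord (y : M)) := by
    intro F _ G hG
    refine continuous_iff_continuousAt.2 fun y => ?_
    exact (hG y y.2).tendsto.comp (tendsto_nhdsWithin_iff.2
      ⟨hcoord.continuousAt.tendsto,
        .of_forall fun z => by simp [coord, OpenPartialHomeomorph.extend]⟩)
  have hD : Continuous fun y : c.chart.source => chartDeriv I f c.chart (c.coord (y : M)) :=
    hcomp fun y hy => (contDiffWithinAt_chartDeriv hf.contMDiff c.chart_mem hy).continuousWithinAt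
  have hH : Continuous fun y : c.chart.source => chartHess I f c.chart (c.coord (y : M)) :=
    hcomp fun y hy => (contDiffWithinAt_chartHess hf.contMDiff c.chart_mem hy).continuousWithinAt
  have hframe : ∀ α, Continuous fun y : c.chart.source => c.frame α (y : M) := fun α =>
    continuousOn_iff_continuous_domRestrict.1 (c.frame_smooth α).continuousOn
  -- Frame components replace the normal projection, whose continuity in the point would otherwise
  -- need its own argument.
  have hnum : ∀ p : c.chart.source × Metric.sphere (0 : EuclideanSpace ℝ (Fin d)) 1,
      ‖curvatureVec I f c.chart p.1 p.2‖ = √ (∑ α, inner ℝ (c.frame α p.1)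
        (chartHess I f c.chart (c.coord (p.1 : M)) p.2 p.2) ^ 2) := by
    intro p
    rw [eq_comm, Real.sqrt_eq_iff_eq_sq (Finset.sum_nonneg fun _ _ => sq_nonneg _)
      (norm_nonneg _), ← c.sum_inner_frame_sq hf p.1.2 (curvatureVec_mem _)]
    refine Finset.sum_congr rfl fun α _ => ?_
    rw [curvatureVec, inner_starProjection_normal (c.frame_normal α _ p.1.2)]
    rfl
  simp_rw [hnum]
  have hw : Continuous fun p : c.chart.source × Metric.sphere (0 : EuclideanSpace ℝ (Fin d)) 1 =>
    (p.2 : EuclideanSpace ℝ (Fin d)) := continuous_subtype_val.comp continuous_snd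
  refine Continuous.div ?_ ?_ ?_
  · refine (continuous_finsetSum _ fun α _ => ?_).sqrt
    refine Continuous.pow (Continuous.inner ((hframe α).comp continuous_fst) ?_) 2
    exact ((hH.comp continuous_fst).clm_apply hw).clm_apply hw
  · exact ((hD.comp continuous_fst).clm_apply hw).norm.pow 2
  · intro p
    refine pow_ne_zero 2 (norm_ne_zero_iff.2 fun h => ?_)
    have h0 := chartDeriv_injective hf c.chart_mem p.1.2 (h.trans (map_zero _).symm)
    have := p.2.2
    rw [mem_sphere_zero_iff_norm, h0, norm_zero] at this
    exact zero_ne_one this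

theorem isGreatest_absCurvature (hd : 0 < d) (hf : IsEmbeddedSubmanifold I f)
    (hx : x ∈ c.chart.source) :
    IsGreatest {t | ∃ v : EuclideanSpace ℝ (Fin d), ‖v‖ = 1 ∧ t = c.curvatureIn (c.coord x) v}
      (absCurvature I f x) := by
  rw [c.curvature_set_eq_quotient hf hx, c.absCurvature_eq hf hx]
  have : Nonempty (Metric.sphere (0 : EuclideanSpace ℝ (Fin d)) 1) :=
    ⟨⟨EuclideanSpace.single ⟨0, hd⟩ 1, by simp⟩⟩
  have hc := (c.continuous_quotient hf).comp
    (Continuous.prodMk_right (⟨x, hx⟩ : c.chart.source))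
  exact (isCompact_range hc).isGreatest_sSup (Set.range_nonempty _)

end BundleCoords

/-- A supremum over a fixed compact sphere of a jointly continuous function is continuous in the
parameter. -/
theorem continuous_absCurvature [IsManifold I ∞ M] (hf : IsEmbeddedSubmanifold I f) :
    Continuous (absCurvature I f) := by
  refine continuous_iff_continuousAt.2 fun x => ?_
  obtain ⟨c, hx⟩ := exists_bundleCoords hf x
  refine ContinuousOn.continuousAt ?_ (c.chart.open_source.mem_nhds hx)
  rw [continuousOn_iff_continuous_domRestrict]
  have h := IsCompact.continuous_sSup (f := fun (y : c.chart.source)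
    (w : Metric.sphere (0 : EuclideanSpace ℝ (Fin d)) 1) => ‖curvatureVec I f c.chart y w‖ /
      ‖chartDeriv I f c.chart (c.coord y) w‖ ^ 2) isCompact_univ
    (by simpa only [Function.HasUncurry.uncurry] using! c.continuous_quotient hf)
  refine h.congr fun y => ?_
  rw [Set.image_univ, Set.domRestrict_apply, c.absCurvature_eq hf y.2]

theorem isGreatest_maxAbsCurvature [IsManifold I ∞ M] [CompactSpace M] [Nonempty M]
    (hf : IsEmbeddedSubmanifold I f) :
    IsGreatest (Set.range (absCurvature I f)) (maxAbsCurvature I f) :=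
  (isCompact_range (continuous_absCurvature hf)).isGreatest_sSup (Set.range_nonempty _)

end Pointwise

/-! ### The scaled metric in coordinates, its determinant and its degeneration -/

namespace BundleCoords

variable {d k : ℕ} {H : Type*} [TopologicalSpace H]
  {I : ModelWithCorners ℝ (EuclideanSpace ℝ (Fin d)) H}
  {M : Type*} [TopologicalSpace M] [ChartedSpace H M]
  {f : M → EuclideanSpace ℝ (Fin (d + k))} {x : M} (c : BundleCoords I f)

/-- The derivative of a frame vector in coordinates. -/
noncomputable def frameDeriv (α : Fin k) (u : EuclideanSpace ℝ (Fin d)) :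
    EuclideanSpace ℝ (Fin d) →L[ℝ] EuclideanSpace ℝ (Fin (d + k)) :=
  fderivWithin ℝ (fun y => c.frame α (c.point y)) (Set.range I) u

theorem fderivWithin_bundleToSpace
    (hf : ContMDiff I 𝓘(ℝ, EuclideanSpace ℝ (Fin (d + k))) ∞ f) (hx : x ∈ c.chart.source)
    (ε : ℝ) (n m : EuclideanSpace ℝ (Fin k)) (w : EuclideanSpace ℝ (Fin d)) :
    fderivWithin ℝ (fun y => bundleToSpace f (scaling ε (c.bundlePoint y)))
        (Set.range I ×ˢ Set.univ) (c.coord x, n) (w, m) =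
      chartDeriv I f c.chart (c.coord x) w +
        ε • ∑ α, (n α • c.frameDeriv α (c.coord x) w + m α • c.frame α x) := by
  have hmaps : Set.MapsTo (Prod.fst : EuclideanSpace ℝ (Fin d) × EuclideanSpace ℝ (Fin k) → _)
      (Set.range I ×ˢ Set.univ) (Set.range I) := fun y hy => hy.1
  have hfst := hasFDerivWithinAt_fst (𝕜 := ℝ) (p := (c.coord x, n))
    (s := (Set.range I ×ˢ (Set.univ : Set (EuclideanSpace ℝ (Fin k)))))
  have hpull : ∀ {g : M → EuclideanSpace ℝ (Fin (d + k))},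
      ContMDiffAt I 𝓘(ℝ, EuclideanSpace ℝ (Fin (d + k))) ∞ g x →
      HasFDerivWithinAt (fun y : EuclideanSpace ℝ (Fin d) × EuclideanSpace ℝ (Fin k) =>
        g (c.point y.1)) ((fderivWithin ℝ (fun y => g (c.point y)) (Set.range I) (c.coord x)).comp
          (ContinuousLinearMap.fst ℝ _ _)) (Set.range I ×ˢ Set.univ) (c.coord x, n) := by
    intro g hg
    have h := ((contDiffWithinAt_comp_extend_symm c.chart_mem hx hg).differentiableWithinAt
      (by simp)).hasFDerivWithinAt
    exact HasFDerivWithinAt.comp (g := fun y => g (c.point y)) (c.coord x, n) h hfst hmaps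
  have hn : ∀ α, HasFDerivWithinAt
      (fun y : EuclideanSpace ℝ (Fin d) × EuclideanSpace ℝ (Fin k) => y.2 α)
      ((EuclideanSpace.proj α : EuclideanSpace ℝ (Fin k) →L[ℝ] ℝ).comp
        (ContinuousLinearMap.snd ℝ (EuclideanSpace ℝ (Fin d)) (EuclideanSpace ℝ (Fin k))))
      (Set.range I ×ˢ Set.univ) (c.coord x, n) := fun α =>
    ContinuousLinearMap.hasFDerivWithinAt
      ((EuclideanSpace.proj α : EuclideanSpace ℝ (Fin k) →L[ℝ] ℝ).comp
        (ContinuousLinearMap.snd ℝ (EuclideanSpace ℝ (Fin d)) (EuclideanSpace ℝ (Fin k))))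
  have hframe := fun α => (hn α).smul
    (hpull ((c.frame_smooth α).contMDiffAt (c.chart.open_source.mem_nhds hx)))
  have htot := (hpull (hf x)).add
    ((HasFDerivWithinAt.fun_sum (u := Finset.univ) fun α _ => hframe α).const_smul ε)
  have huniq : UniqueDiffWithinAt ℝ
      (Set.range I ×ˢ (Set.univ : Set (EuclideanSpace ℝ (Fin k)))) (c.coord x, n) :=
    (uniqueDiffWithinAt_extend c.chart x).prod uniqueDiffWithinAt_univ
  have h := DFunLike.congr_fun (htot.fderivWithin huniq) (w, m)
  refine Eq.trans h ?_
  simp only [_root_.add_apply, _root_.smul_apply, _root_.sum_apply,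
    ContinuousLinearMap.comp_apply, ContinuousLinearMap.coe_fst', ContinuousLinearMap.coe_snd',
    ContinuousLinearMap.smulRight_apply, c.point_coord hx]
  rfl

theorem scaledMetric_eq_gram
    (hf : ContMDiff I 𝓘(ℝ, EuclideanSpace ℝ (Fin (d + k))) ∞ f) (hx : x ∈ c.chart.source)
    (ε : ℝ) (n : EuclideanSpace ℝ (Fin k)) :
    c.scaledMetric ε (c.coord x, n) = gram ℝ (Sum.elim
      (fun i => chartDeriv I f c.chart (c.coord x) (EuclideanSpace.single i (1 : ℝ)) +
        ε • ∑ α, n α • c.frameDeriv α (c.coord x) (EuclideanSpace.single i (1 : ℝ)))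
      (fun α => ε • c.frame α x)) := by
  have h : ∀ a, fderivWithin ℝ (fun y => bundleToSpace f (scaling ε (c.bundlePoint y)))
      (Set.range I ×ˢ Set.univ) (c.coord x, n) (coordVec a) = Sum.elim
      (fun i => chartDeriv I f c.chart (c.coord x) (EuclideanSpace.single i (1 : ℝ)) +
        ε • ∑ α, n α • c.frameDeriv α (c.coord x) (EuclideanSpace.single i (1 : ℝ)))
      (fun α => ε • c.frame α x) a := by
    rintro (i | α)
    · rw [coordVec, c.fderivWithin_bundleToSpace hf hx]
      simp
    · rw [coordVec, c.fderivWithin_bundleToSpace hf hx]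
      simp
  ext a b
  simp only [scaledMetric, Matrix.of_apply, h, gram_apply]

/-- The symmetric matrix `ε g_B^{-1/2} (∑ n^α H_α) g_B^{-1/2}`. -/
noncomputable def shapeOperator (ε : ℝ) (u : EuclideanSpace ℝ (Fin d))
    (n : EuclideanSpace ℝ (Fin k)) : Matrix (Fin d) (Fin d) ℝ :=
  ε • ∑ α, n α • (c.baseMetricInvSqrt u * c.shapeMatrix α u * c.baseMetricInvSqrt u)

theorem shapeOperator_isHermitian
    (hf : ContMDiff I 𝓘(ℝ, EuclideanSpace ℝ (Fin (d + k))) ∞ f) (hx : x ∈ c.chart.source)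
    (ε : ℝ) (n : EuclideanSpace ℝ (Fin k)) : (c.shapeOperator ε (c.coord x) n).IsHermitian := by
  have h : ∀ α, (c.baseMetricInvSqrt (c.coord x) * c.shapeMatrix α (c.coord x) *
      c.baseMetricInvSqrt (c.coord x))ᴴ = c.baseMetricInvSqrt (c.coord x) *
      c.shapeMatrix α (c.coord x) * c.baseMetricInvSqrt (c.coord x) := fun α => by
    rw [conjTranspose_mul, conjTranspose_mul, c.baseMetricInvSqrt_isHermitian _,
      c.shapeMatrix_isHermitian hf hx, mul_assoc]
  simp only [IsHermitian, shapeOperator, conjTranspose_smul, conjTranspose_sum, h, star_trivial]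

theorem form_shapeOperator (ε : ℝ) (u : EuclideanSpace ℝ (Fin d))
    (n : EuclideanSpace ℝ (Fin k)) (v : Fin d → ℝ) :
    v ⬝ᵥ c.shapeOperator ε u n *ᵥ v = ε * ∑ α, n α * (v ⬝ᵥ
      (c.baseMetricInvSqrt u * c.shapeMatrix α u * c.baseMetricInvSqrt u) *ᵥ v) := by
  simp only [shapeOperator, smul_mulVec, sum_mulVec, dotProduct_smul, dotProduct_sum, smul_eq_mul]

variable [IsManifold I ∞ M]

/-- Conjugation by $g_B^{-1/2}$ turns $g_B-\varepsilon\sum_\alpha n^\alpha H_\alpha$, the matrix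
left by the Gram computation, into $1-S$. -/
theorem det_scaledMetric (hf : IsEmbeddedSubmanifold I f) (hx : x ∈ c.chart.source)
    (ε : ℝ) (n : EuclideanSpace ℝ (Fin k)) :
    (c.scaledMetric ε (c.coord x, n)).det = ε ^ (2 * k) * (c.baseMetric (c.coord x)).det *
      (1 - c.shapeOperator ε (c.coord x) n).det ^ 2 := by
  have hg := c.baseMetric_posDef hf hx
  have hdet := hg.det_pos
  have key := det_gram_sumElim finSumFinEquiv
    (fun i => chartDeriv I f c.chart (c.coord x) (EuclideanSpace.single i (1 : ℝ)))
    (fun i => ∑ α, n α • c.frameDeriv α (c.coord x) (EuclideanSpace.single i (1 : ℝ)))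
    (fun α => c.frame α x) (c.frame_orthonormal x hx)
    (fun α i => inner_chartDeriv_eq_zero hf.contMDiff c.chart_mem hx (c.frame_normal α x hx) _) ε
  have hS : (Matrix.of fun i j => inner ℝ
      (∑ α, n α • c.frameDeriv α (c.coord x) (EuclideanSpace.single i (1 : ℝ)))
      (chartDeriv I f c.chart (c.coord x) (EuclideanSpace.single j (1 : ℝ)))) =
      - ∑ α, n α • c.shapeMatrix α (c.coord x) := by
    ext i j
    simp only [Matrix.of_apply, sum_inner, real_inner_smul_left, Matrix.neg_apply,
      Matrix.sum_apply, Matrix.smul_apply, smul_eq_mul, c.shapeMatrix_coord hf.contMDiff hx]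
    rw [← Finset.sum_neg_distrib]
    refine Finset.sum_congr rfl fun α _ => ?_
    have h := inner_fderivWithin_normal_field hf.contMDiff c.chart_mem hx
      ((c.frame_smooth α).contMDiffAt (c.chart.open_source.mem_nhds hx))
      (Filter.mem_of_superset (c.chart.open_source.mem_nhds hx) (c.frame_normal α))
      (EuclideanSpace.single i 1) (EuclideanSpace.single j 1)
    rw [← mul_neg]
    exact congrArg (n α * ·) h
  rw [hS, ← c.scaledMetric_eq_gram hf.contMDiff hx, ← c.baseMetric_eq_gram, Fintype.card_fin]
    at key
  have hconj : 1 - c.shapeOperator ε (c.coord x) n = c.baseMetricInvSqrt (c.coord x) *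
      (c.baseMetric (c.coord x) + ε • -∑ α, n α • c.shapeMatrix α (c.coord x)) *
        c.baseMetricInvSqrt (c.coord x) := by
    have h1 : c.baseMetricInvSqrt (c.coord x) * c.baseMetric (c.coord x) *
      c.baseMetricInvSqrt (c.coord x) = 1 := invSqrt_mul_mul_invSqrt hg
    rw [mul_add, add_mul, h1, shapeOperator, smul_neg, mul_neg, neg_mul, ← sub_eq_add_neg,
      mul_smul_comm, smul_mul_assoc, Finset.mul_sum, Finset.sum_mul]
    simp only [mul_smul_comm, smul_mul_assoc]
  have hR : (c.baseMetricInvSqrt (c.coord x)).det ^ 2 * (c.baseMetric (c.coord x)).det = 1 := by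
    have h1 := congrArg det (invSqrt_mul_mul_invSqrt hg)
    rw [det_mul, det_mul, det_one] at h1
    rw [← h1, baseMetricInvSqrt]
    ring
  rw [hconj, det_mul, det_mul]
  refine mul_right_cancel₀ hdet.ne' (key.trans ?_)
  generalize (c.baseMetric (c.coord x) + ε • -∑ α, n α • c.shapeMatrix α (c.coord x)).det = X
  -- With $\rho=\det(g_B^{-1/2})^2\det g_B=1$, the two sides differ by
  -- $(\varepsilon^kX)^2(1-\rho^2)$, which has the factor $\rho-1$.
  linear_combination (-(ε ^ k * X) ^ 2 *
    ((c.baseMetricInvSqrt (c.coord x)).det ^ 2 * (c.baseMetric (c.coord x)).det + 1)) * hR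

theorem curvatureIn_le (hd : 0 < d) (hf : IsEmbeddedSubmanifold I f) (hx : x ∈ c.chart.source)
    (v : EuclideanSpace ℝ (Fin d)) :
    c.curvatureIn (c.coord x) v ≤ absCurvature I f x * ‖v‖ ^ 2 := by
  have hsmul : ∀ (s : ℝ) w, c.curvatureIn (c.coord x) (s • w) =
      s ^ 2 * c.curvatureIn (c.coord x) w := by
    intro s w
    have hn : c.normalize (c.coord x) (s • w) = s • c.normalize (c.coord x) w := by
      simp only [normalize, WithLp.ofLp_smul, mulVec_smul, WithLp.toLp_smul]
    rw [c.curvatureIn_coord hf hx, c.curvatureIn_coord hf hx, hn, curvatureVec_smul, norm_smul,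
      norm_pow, Real.norm_eq_abs, sq_abs]
  rcases eq_or_ne v 0 with rfl | hv
  · have := hsmul 0 0
    simp only [zero_smul] at this
    rw [this]
    simp
  · have hn := norm_pos_iff.2 hv
    have h1 := (c.isGreatest_absCurvature hd hf hx).2 ⟨‖v‖⁻¹ • v, by simp [norm_smul, hn.ne'], rfl⟩
    rw [hsmul, inv_pow, inv_mul_le_iff₀ (by positivity)] at h1
    linarith

/-- Cauchy-Schwarz in $\mathbb{R}^k$ separates `n` from the vector of forms, whose norm is
`curvatureIn`; the lower bound is the same inequality for `-n`. -/
theorem abs_form_shapeOperator_le (hd : 0 < d) (hf : IsEmbeddedSubmanifold I f)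
    (hx : x ∈ c.chart.source) {ε : ℝ} (hε : 0 < ε) (n : EuclideanSpace ℝ (Fin k))
    (v : Fin d → ℝ) :
    |v ⬝ᵥ c.shapeOperator ε (c.coord x) n *ᵥ v| ≤
      ε * ‖n‖ * absCurvature I f x * (v ⬝ᵥ v) := by
  have hv : v ⬝ᵥ v = ‖(WithLp.toLp 2 v : EuclideanSpace ℝ (Fin d))‖ ^ 2 := by
    rw [EuclideanSpace.real_norm_sq_eq]
    simp [dotProduct, sq]
  rw [form_shapeOperator, abs_mul, abs_of_pos hε, hv, mul_assoc, mul_assoc]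
  refine mul_le_mul_of_nonneg_left ?_ hε.le
  refine le_trans ?_ (mul_le_mul_of_nonneg_left
    (c.curvatureIn_le hd hf hx (WithLp.toLp 2 v)) (norm_nonneg n))
  rw [EuclideanSpace.norm_eq, curvatureIn]
  refine abs_le.2 ⟨?_, ?_⟩
  · rw [neg_le, ← Finset.sum_neg_distrib]
    have h := Real.sum_mul_le_sqrt_mul_sqrt Finset.univ (fun α => -n α) (fun α => v ⬝ᵥ
      (c.baseMetricInvSqrt (c.coord x) * c.shapeMatrix α (c.coord x) *
        c.baseMetricInvSqrt (c.coord x)) *ᵥ v)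
    simpa using h
  · have h := Real.sum_mul_le_sqrt_mul_sqrt Finset.univ (fun α => n α) (fun α => v ⬝ᵥ
      (c.baseMetricInvSqrt (c.coord x) * c.shapeMatrix α (c.coord x) *
        c.baseMetricInvSqrt (c.coord x)) *ᵥ v)
    simpa using h

omit [IsManifold I ∞ M] in
theorem norm_bundlePoint (hx : x ∈ c.chart.source) (n : EuclideanSpace ℝ (Fin k)) :
    ‖(c.bundlePoint (c.coord x, n)).2‖ = ‖n‖ := by
  have h := (c.frame_orthonormal x hx).inner_sum n.ofLp n.ofLp Finset.univ
  rw [real_inner_self_eq_norm_sq] at h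
  simp only [bundlePoint, c.point_coord hx]
  refine (sq_eq_sq₀ (norm_nonneg _) (norm_nonneg _)).1 (h.trans ?_)
  rw [EuclideanSpace.real_norm_sq_eq]
  simp [sq]

omit [IsManifold I ∞ M] in
theorem bundlePoint_mem_normalSubspace (hx : x ∈ c.chart.source) (n : EuclideanSpace ℝ (Fin k)) :
    (c.bundlePoint (c.coord x, n)).2 ∈
      normalSubspace I f (c.bundlePoint (c.coord x, n)).1 := by
  simp only [bundlePoint, c.point_coord hx]
  exact Submodule.sum_mem _ fun α _ => Submodule.smul_mem _ _ (c.frame_normal α x hx)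

omit [IsManifold I ∞ M] in
theorem exists_coord_eq {u : EuclideanSpace ℝ (Fin d)} (hu : u ∈ c.domain) :
    ∃ x ∈ c.chart.source, c.coord x = u :=
  ⟨c.point u, c.chart.extend_source (I := I) ▸ (c.chart.extend I).map_target hu,
    (c.chart.extend I).right_inv hu⟩

theorem scaledMetric_posDef (hd : 0 < d) (hf : IsEmbeddedSubmanifold I f)
    (hx : x ∈ c.chart.source) {ε : ℝ} (hε : 0 < ε) {n : EuclideanSpace ℝ (Fin k)}
    (h : ε * ‖n‖ * absCurvature I f x < 1) : (c.scaledMetric ε (c.coord x, n)).PosDef := by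
  have hps : (c.scaledMetric ε (c.coord x, n)).PosSemidef := by
    rw [c.scaledMetric_eq_gram hf.contMDiff hx]
    exact posSemidef_gram ℝ _
  rw [hps.posDef_iff_det_ne_zero, c.det_scaledMetric hf hx]
  have h1 := (det_one_sub_bounds (c.shapeOperator_isHermitian hf.contMDiff hx ε n)
    (c.abs_form_shapeOperator_le hd hf hx hε n)).2 h.le
  have h2 := (pow_pos (sub_pos.2 h) _).trans_le h1
  have := (c.baseMetric_posDef hf hx).det_pos
  positivity

end BundleCoords

variable {d k : ℕ} {H : Type*} [TopologicalSpace H]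
  {I : ModelWithCorners ℝ (EuclideanSpace ℝ (Fin d)) H}
  {M : Type*} [TopologicalSpace M] [ChartedSpace H M] [IsManifold I ∞ M]
  {f : M → EuclideanSpace ℝ (Fin (d + k))} {x : M}

theorem absCurvature_nonneg (hd : 0 < d) (hf : IsEmbeddedSubmanifold I f) (x : M) :
    0 ≤ absCurvature I f x := by
  obtain ⟨c, hx⟩ := exists_bundleCoords hf x
  obtain ⟨v, -, hv⟩ := (c.isGreatest_absCurvature hd hf hx).1
  rw [hv]
  exact Real.sqrt_nonneg _

/-- At the focal distance along the direction of greatest curvature the metric degenerates. -/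
theorem exists_not_posDef (hd : 0 < d) (hf : IsEmbeddedSubmanifold I f) {ε : ℝ} (hε : 0 < ε)
    (hκ : 0 < absCurvature I f x) :
    ∃ (c : BundleCoords I f) (n : EuclideanSpace ℝ (Fin k)), x ∈ c.chart.source ∧
      ε * ‖n‖ * absCurvature I f x = 1 ∧ ¬ (c.scaledMetric ε (c.coord x, n)).PosDef := by
  obtain ⟨c, hx⟩ := exists_bundleCoords hf x
  obtain ⟨v, hv, hκv⟩ := (c.isGreatest_absCurvature hd hf hx).1
  set κ := absCurvature I f x with hκdef
  set a : Fin k → ℝ := fun α => v.ofLp ⬝ᵥ (c.baseMetricInvSqrt (c.coord x) *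
    c.shapeMatrix α (c.coord x) * c.baseMetricInvSqrt (c.coord x)) *ᵥ v.ofLp with ha
  have hsum : ∑ α, a α ^ 2 = κ ^ 2 := by
    rw [hκv, BundleCoords.curvatureIn, Real.sq_sqrt (Finset.sum_nonneg fun _ _ => sq_nonneg _)]
  -- Cauchy-Schwarz is an equality for `n` parallel to `a`. Since `a` has norm `κ`, this factor
  -- gives length `1 / (ε * κ)`, which makes the form equal to `1` at `v`.
  let n : EuclideanSpace ℝ (Fin k) := (ε * κ ^ 2)⁻¹ • WithLp.toLp 2 a
  have hn : ε * ‖n‖ * κ = 1 := by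
    have h1 : ‖(WithLp.toLp 2 a : EuclideanSpace ℝ (Fin k))‖ = κ := by
      refine (sq_eq_sq₀ (norm_nonneg _) hκ.le).1 ?_
      rw [EuclideanSpace.real_norm_sq_eq]
      exact hsum
    rw [norm_smul, h1, Real.norm_of_nonneg (by positivity)]
    field_simp
  refine ⟨c, n, hx, hn, fun hpos => hpos.det_pos.ne' ?_⟩
  have hvv : v.ofLp ⬝ᵥ v.ofLp = 1 := by
    have h := (EuclideanSpace.real_norm_sq_eq v).symm
    rw [hv] at h
    simpa [dotProduct, sq] using h
  have hzero : (1 - c.shapeOperator ε (c.coord x) n).det = 0 := by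
    refine det_one_sub_eq_zero (c.shapeOperator_isHermitian hf.contMDiff hx ε n) (fun w => ?_)
      (w := v.ofLp) ?_ ?_
    · have h := (abs_le.1 (c.abs_form_shapeOperator_le hd hf hx hε n w)).2
      rwa [hn, one_mul] at h
    · intro h
      rw [h, zero_dotProduct] at hvv
      exact zero_ne_one hvv
    · rw [c.form_shapeOperator, hvv]
      have : ∑ α, n α * a α = (ε * κ ^ 2)⁻¹ * ∑ α, a α ^ 2 := by
        rw [Finset.mul_sum]
        exact Finset.sum_congr rfl fun α _ => by simp [n]; ring
      rw [this, hsum]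
      field_simp
  rw [c.det_scaledMetric hf hx, hzero]
  ring

/-! ### Positivity on the disc bundles and the determinant bounds -/

section Main

variable [CompactSpace M] [Nonempty M]

theorem maxAbsCurvature_nonneg (hd : 0 < d) (hf : IsEmbeddedSubmanifold I f) :
    0 ≤ maxAbsCurvature I f := by
  obtain ⟨x, hx⟩ := (isGreatest_maxAbsCurvature hf).1
  exact hx ▸ absCurvature_nonneg hd hf x

theorem absCurvature_le_max (hf : IsEmbeddedSubmanifold I f) (x : M) :
    absCurvature I f x ≤ maxAbsCurvature I f :=
  (isGreatest_maxAbsCurvature hf).2 ⟨x, rfl⟩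

theorem posDefOn_closedNormalBundle_iff (hd : 0 < d) (hf : IsEmbeddedSubmanifold I f)
    {ε r : ℝ} (hε : 0 < ε) (hr : 0 < r) :
    PosDefOn I f ε (closedNormalBundle I f r) ↔ ε * r * maxAbsCurvature I f < 1 := by
  have hκ := maxAbsCurvature_nonneg (I := I) hd hf
  constructor
  · intro h
    by_contra! hge
    obtain ⟨x, hx⟩ := (isGreatest_maxAbsCurvature (I := I) hf).1
    have hpos : 0 < maxAbsCurvature I f := by
      rcases hκ.eq_or_lt with h0 | h0
      · rw [← h0, mul_zero] at hge
        linarith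
      · exact h0
    rw [← hx] at hpos hge
    -- At a point of greatest curvature the metric degenerates at radius $1/(\varepsilon\kappa^*)$,
    -- which is at most `r`.
    obtain ⟨c, n, hxc, hn, hnot⟩ := exists_not_posDef hd hf hε hpos
    refine hnot (h c _ n ((c.chart.extend I).map_source (by simpa using hxc))
      ⟨c.bundlePoint_mem_normalSubspace hxc n, ?_⟩)
    rw [c.norm_bundlePoint hxc]
    rw [← hn] at hge
    exact le_of_mul_le_mul_left (le_of_mul_le_mul_right hge hpos) hε
  · intro h c u n hu hmem
    obtain ⟨x, hx, rfl⟩ := c.exists_coord_eq hu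
    have hn : ‖n‖ ≤ r := (c.norm_bundlePoint hx n) ▸ hmem.2
    refine c.scaledMetric_posDef hd hf hx hε (lt_of_le_of_lt ?_ h)
    have := absCurvature_nonneg hd hf x
    have := absCurvature_le_max hf x
    gcongr

theorem posDefOn_openNormalBundle_iff (hd : 0 < d) (hf : IsEmbeddedSubmanifold I f)
    {ε r : ℝ} (hε : 0 < ε) (hr : 0 < r) :
    PosDefOn I f ε (openNormalBundle I f r) ↔ ε * r * maxAbsCurvature I f ≤ 1 := by
  have hκ := maxAbsCurvature_nonneg (I := I) hd hf
  constructor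
  · intro h
    by_contra! hge
    obtain ⟨x, hx⟩ := (isGreatest_maxAbsCurvature (I := I) hf).1
    have hpos : 0 < maxAbsCurvature I f := by
      rcases hκ.eq_or_lt with h0 | h0
      · rw [← h0, mul_zero] at hge
        linarith
      · exact h0
    rw [← hx] at hpos hge
    obtain ⟨c, n, hxc, hn, hnot⟩ := exists_not_posDef hd hf hε hpos
    refine hnot (h c _ n ((c.chart.extend I).map_source (by simpa using hxc))
      ⟨c.bundlePoint_mem_normalSubspace hxc n, ?_⟩)
    rw [c.norm_bundlePoint hxc]
    rw [← hn] at hge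
    exact lt_of_mul_lt_mul_left (lt_of_mul_lt_mul_right hge hpos.le) hε.le
  · intro h c u n hu hmem
    obtain ⟨x, hx, rfl⟩ := c.exists_coord_eq hu
    have hn : ‖n‖ < r := (c.norm_bundlePoint hx n) ▸ hmem.2
    refine c.scaledMetric_posDef hd hf hx hε ?_
    have h1 := absCurvature_le_max hf x
    -- Strictness comes from `‖n‖ < r` only when the curvature at `x` is positive.
    rcases (absCurvature_nonneg hd hf x).eq_or_lt with h0 | h0
    · rw [← h0, mul_zero]
      exact one_pos
    · calc ε * ‖n‖ * absCurvature I f x < ε * r * absCurvature I f x := by gcongr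
        _ ≤ ε * r * maxAbsCurvature I f := by gcongr
        _ ≤ 1 := h

theorem det_scaledMetric_bounds (hd : 0 < d) (hf : IsEmbeddedSubmanifold I f)
    {ε r : ℝ} (hε : 0 < ε) (c : BundleCoords I f) (hx : x ∈ c.chart.source)
    {n : EuclideanSpace ℝ (Fin k)} (hn : ‖n‖ ≤ r) :
    (ε * r * maxAbsCurvature I f ≤ 1 →
        ε ^ (2 * k) * (c.baseMetric (c.coord x)).det *
            (1 - ε * r * maxAbsCurvature I f) ^ (2 * d)
          ≤ (c.scaledMetric ε (c.coord x, n)).det) ∧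
      (c.scaledMetric ε (c.coord x, n)).det ≤
        ε ^ (2 * k) * (c.baseMetric (c.coord x)).det *
          (1 + ε * r * maxAbsCurvature I f) ^ (2 * d) := by
  have hκ := absCurvature_nonneg hd hf x
  have hle := absCurvature_le_max hf x
  have hr := (norm_nonneg n).trans hn
  have hb := det_one_sub_bounds (c := ε * r * maxAbsCurvature I f)
    (c.shapeOperator_isHermitian hf.contMDiff hx ε n) (fun v => by
      refine (c.abs_form_shapeOperator_le hd hf hx hε n v).trans ?_
      have : 0 ≤ v ⬝ᵥ v := Finset.sum_nonneg fun i _ => mul_self_nonneg _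
      gcongr)
  rw [Fintype.card_fin] at hb
  have hg := (c.baseMetric_posDef hf hx).det_pos
  rw [c.det_scaledMetric hf hx, mul_comm 2 d, pow_mul _ d 2, pow_mul _ d 2]
  constructor
  · intro h
    have h1 := hb.2 h
    have h2 : 0 ≤ (1 - ε * r * maxAbsCurvature I f) ^ d := pow_nonneg (sub_nonneg.2 h) _
    gcongr
  -- Only the absolute value of this determinant enters its square, so the upper bound needs no
  -- smallness condition.
  · rw [← sq_abs (1 - c.shapeOperator ε (c.coord x) n).det]
    have h1 := hb.1
    gcongr

end Main

end TubeMetric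

theorem mainTheorem10 {d k : ℕ} (hd : 0 < d) {H : Type*} [TopologicalSpace H]
    (I : ModelWithCorners ℝ (EuclideanSpace ℝ (Fin d)) H)
    {M : Type*} [TopologicalSpace M] [ChartedSpace H M] [IsManifold I ∞ M]
    [CompactSpace M] [Nonempty M]
    (f : M → EuclideanSpace ℝ (Fin (d + k)))
    (hf : TubeMetric.IsEmbeddedSubmanifold I f)
    (ε r : ℝ) (hε : 0 < ε) (hr : 0 < r) :
    -- local coordinates with an orthonormal normal frame exist around every point
    (∀ x : M, ∃ c : TubeMetric.BundleCoords I f, x ∈ c.chart.source) ∧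
    -- the maxima defining the curvatures exist, the first one being the same in all coordinates
    (∀ (c : TubeMetric.BundleCoords I f), ∀ x ∈ c.chart.source,
      IsGreatest {t | ∃ v : EuclideanSpace ℝ (Fin d), ‖v‖ = 1 ∧ t = c.curvatureIn (c.coord x) v}
        (TubeMetric.absCurvature I f x)) ∧
    IsGreatest (Set.range (TubeMetric.absCurvature I f)) (TubeMetric.maxAbsCurvature I f) ∧
    -- positivity on the closed disc bundle of radius r, and on the open one
    (TubeMetric.PosDefOn I f ε (TubeMetric.closedNormalBundle I f r) ↔
      ε * r * TubeMetric.maxAbsCurvature I f < 1) ∧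
    (TubeMetric.PosDefOn I f ε (TubeMetric.openNormalBundle I f r) ↔
      ε * r * TubeMetric.maxAbsCurvature I f ≤ 1) ∧
    -- bounds on the determinant
    (∀ (c : TubeMetric.BundleCoords I f) (u : EuclideanSpace ℝ (Fin d))
      (n : EuclideanSpace ℝ (Fin k)), u ∈ c.domain →
      c.bundlePoint (u, n) ∈ TubeMetric.closedNormalBundle I f r →
      (ε * r * TubeMetric.maxAbsCurvature I f ≤ 1 →
        ε ^ (2 * k) * (c.baseMetric u).det *
            (1 - ε * r * TubeMetric.maxAbsCurvature I f) ^ (2 * d)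
          ≤ (c.scaledMetric ε (u, n)).det) ∧
      (c.scaledMetric ε (u, n)).det ≤
        ε ^ (2 * k) * (c.baseMetric u).det *
          (1 + ε * r * TubeMetric.maxAbsCurvature I f) ^ (2 * d)) := by
  refine ⟨TubeMetric.exists_bundleCoords hf, fun c x hx => c.isGreatest_absCurvature hd hf hx,
    TubeMetric.isGreatest_maxAbsCurvature hf,
    TubeMetric.posDefOn_closedNormalBundle_iff hd hf hε hr,
    TubeMetric.posDefOn_openNormalBundle_iff hd hf hε hr, fun c u n hu hmem => ?_⟩
  obtain ⟨x, hx, rfl⟩ := c.exists_coord_eq hu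
  exact TubeMetric.det_scaledMetric_bounds hd hf hε c hx ((c.norm_bundlePoint hx n) ▸ hmem.2)
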